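/- Let $M_h\subset\mathbb R^3$ be a triangulated surface, i.e. the union of the triangles of a finite conforming simplicial complex of non-degenerate triangles in $\mathbb R^3$, with boundary $\Gamma_h$ (the union of the edges that lie in exactly one triangle), and let $a,b:M_h\to\mathbb R$ be measurable with $0<\underline a\le a\le\overline a$ and $0\le b\le\overline b$ almost everywhere. Let $V_h$ be the space of continuous piecewise linear functions on $M_h$ which vanish on $\Gamma_h$ if $\Gamma_h\ne\emptyset$, and which have mean value zero if $\Gamma_h=\emptyset$ and $b=0$ a.e.; equip $V_h$ with the inner product and norm of $L^2(M_h)$. Let $\mathcal L_h:V_h\to V_h$ be the self-adjoint operator defined by $$\int_{M_h}(\mathcal L_h w)\,v=\int_{M_h}\bigl(a\,\nabla_{M_h}w\cdot\nabla_{M_h}v+b\,w\,v\bigr)\qquad\text{for all } w,v\in V_h ,$$ let $\lambda_{h,\min}$ and $\lambda_{h,\max}$ be its smallest and largest eigenvalues, and let $\hat\lambda\in(0,\lambda_{h,\min}]$ and $\mathcal B_h=\mathcal L_h-\hat\lambda\mathcal I$. For $\alpha\in(0,1)$ the power $\mathcal L_h^{-\alpha}$ is defined through an orthonormal basis of eigenfunctions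 of $\mathcal L_h$. Let $\alpha\in(0,1)$ and let $m\ge1$ be an integer. Let $r_m=P_m/Q_m$ be the diagonal Padé approximant of $(1+t)^{-\alpha}$: $P_m,Q_m$ are real polynomials of degree at most $m$ with $Q_m(0)=1$, and the Maclaurin coefficients of $P_m/Q_m$ and $(1+t)^{-\alpha}$ agree up to order $t^{2m}$. (The pair $(P_m,Q_m)$ exists and is unique.) Let $0=t_0<t_1<\dots<t_{L+1}=1$ with $L\ge0$, $\tau_n=t_{n+1}-t_n$, and $$\theta_n(\lambda)=\frac{\tau_n(\lambda-\hat\lambda)}{\hat\lambda+t_n(\lambda-\hat\lambda)},\qquad n=0,\dots,L .$$ Suppose that $\theta_n(\lambda_{h,\max})\le1$ for $n=0,\dots,L$, and that $\nu\ge0$ satisfies $\tau_{n+1}/\tau_n\le\nu$ for $n=0,\dots,L-1$. Put $$\mu(\lambda)=\hat\lambda^{-\alpha}\prod_{k=0}^{L}r_m(\theta_k(\lambda)),\qquad U_{L+1}=\hat\lambda^{-\alpha}\prod_{k=0}^{L}r_m\bigl(\tau_k\mathcal B_h(\hat\lambda\mathcal I+t_k\mathcal B_h)^{-1}\bigr)f_h\quad(f_h\in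 V_h),$$ $$\widetilde c=(\alpha+\nu)\,2^{\alpha}\,\frac{c'_\alpha}{\alpha},\qquad c'_\alpha=\frac{\alpha\pi}{2\,\Gamma(1-\alpha)\,\Gamma(1+\alpha)} .$$ Then $Q_m(\theta_n(\lambda))\ne0$ for all $n\le L$ and $\lambda\in[\lambda_{h,\min},\lambda_{h,\max}]$, all operator inverses in the definition of $U_{L+1}$ (those of $\hat\lambda\mathcal I+t_k\mathcal B_h$ and of the denominators $Q_m(\cdot)$) exist, and $$|\lambda^{-\alpha}-\mu(\lambda)|\le\widetilde c\,\hat\lambda^{-\alpha}\,2^{-5m}\qquad\text{for all }\lambda\in[\lambda_{h,\min},\lambda_{h,\max}],$$ $$\|\mathcal L_h^{-\alpha}f_h-U_{L+1}\|_{L^2(M_h)}\le\widetilde c\,\hat\lambda^{-\alpha}\,2^{-5m}\,\|f_h\|_{L^2(M_h)}\qquad\text{for all }f_h\in V_h .$$ -/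

import Mathlib

open MeasureTheory Polynomial

noncomputable section

namespace PadeFEM

/-! ### Triangulated surfaces in three-dimensional Euclidean space -/

/-- Three-dimensional Euclidean space. -/
abbrev R3 : Type := EuclideanSpace ℝ (Fin 3)

/-- A triangulated surface: a finite simplicial complex in `ℝ³`, all of whose simplices are faces
of (non-degenerate) triangles of the complex. -/
structure TriangulatedSurface where
  complex : Geometry.SimplicialComplex ℝ R3
  finite : complex.faces.Finite
  pure : ∀ s ∈ complex.faces, ∃ t ∈ complex.faces, s ⊆ t ∧ t.card = 3

/-- The solid (closed) simplex with the given vertices. -/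
def solid (t : Finset R3) : Set R3 := convexHull ℝ (t : Set R3)

namespace TriangulatedSurface

variable (S : TriangulatedSurface)

/-- The triangles of the surface, given by their sets of vertices. -/
def triangles : Finset (Finset R3) := S.finite.toFinset.filter (fun t => t.card = 3)

/-- The surface `M_h` as a set of points: the union of all its triangles. -/
def points : Set R3 := ⋃ t ∈ S.triangles, solid t

/-- The boundary of the surface: the union of the edges that lie in exactly one triangle. -/
def boundary : Set R3 :=
  ⋃ e ∈ {e : Finset R3 | e.card = 2 ∧ ∃! t, t ∈ S.triangles ∧ e ⊆ t}, solid e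

end TriangulatedSurface

/-- The surface measure (two-dimensional Hausdorff measure, normalized so that it is the Lebesgue
measure on planes) on a subset of `ℝ³`. -/
def area (A : Set R3) : Measure R3 := (Measure.euclideanHausdorffMeasure 2).restrict A

/-- Coefficients of a second order elliptic operator on a triangulated surface. They are given as
functions on `ℝ³`, of which only the values on the surface matter. -/
structure Coefficients (S : TriangulatedSurface) where
  a : R3 → ℝ
  b : R3 → ℝ
  a_meas : AEStronglyMeasurable a (area S.points)
  b_meas : AEStronglyMeasurable b (area S.points)
  a_bounds : ∃ lo hi : ℝ, 0 < lo ∧ ∀ᵐ x ∂(area S.points), lo ≤ a x ∧ a x ≤ hi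
  b_bounds : ∃ hi : ℝ, ∀ᵐ x ∂(area S.points), 0 ≤ b x ∧ b x ≤ hi

/-! ### Surface measure of a triangle -/

lemma TriangulatedSurface.card_of_mem {S : TriangulatedSurface} {t : Finset R3}
    (ht : t ∈ S.triangles) : t.card = 3 := (Finset.mem_filter.1 ht).2

lemma TriangulatedSurface.face_of_mem {S : TriangulatedSurface} {t : Finset R3}
    (ht : t ∈ S.triangles) : t ∈ S.complex.faces := by
  have := (Finset.mem_filter.1 ht).1
  simpa using this

lemma TriangulatedSurface.indep_of_mem {S : TriangulatedSurface} {t : Finset R3}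
    (ht : t ∈ S.triangles) : AffineIndependent ℝ ((↑) : t → R3) :=
  S.complex.indep (S.face_of_mem ht)

lemma solid_compact (t : Finset R3) : IsCompact (solid t) :=
  t.finite_toSet.isCompact_convexHull ℝ

lemma solid_subset_points {S : TriangulatedSurface} {t : Finset R3} (ht : t ∈ S.triangles) :
    solid t ⊆ S.points :=
  Set.subset_biUnion_of_mem (u := fun t => solid t) ht

lemma points_compact (S : TriangulatedSurface) : IsCompact S.points :=
  S.triangles.isCompact_biUnion (fun t _ => solid_compact t)

/-- A plane carrying a triangle, as an isometric image of a Euclidean plane. -/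
lemma exists_chart {t : Finset R3} (hc : t.card = 3) (hi : AffineIndependent ℝ ((↑) : t → R3)) :
    ∃ (W : Submodule ℝ R3) (g : W → R3), Isometry g ∧ solid t ⊆ Set.range g ∧
      Module.finrank ℝ W = 2 ∧ IsCompact (g ⁻¹' solid t) ∧
      g ⁻¹' solid t ⊆ closure (interior (g ⁻¹' solid t)) := by
  obtain ⟨p, hp⟩ : t.Nonempty := Finset.card_pos.1 (by omega)
  have hp' : p ∈ (t : Set R3) := hp
  set W : Submodule ℝ R3 := vectorSpan ℝ (t : Set R3) with hW
  let gL : W →ᵃ[ℝ] R3 := W.subtype.toAffineMap + AffineMap.const ℝ W p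
  have hg : ∀ w : W, gL w = (w : R3) + p := fun w => rfl
  have hiso : Isometry gL := by
    refine Isometry.of_dist_eq fun x y => ?_
    rw [hg, hg, dist_add_right]; rfl
  have hrange : ∀ x : R3, x - p ∈ W → x ∈ Set.range gL := fun x hx =>
    ⟨⟨x - p, hx⟩, by rw [hg]; simp⟩
  have hts : (t : Set R3) ⊆ Set.range gL := fun x hx =>
    hrange x (vsub_mem_vectorSpan ℝ hx hp')
  have hsub : solid t ⊆ Set.range gL := by
    refine convexHull_min hts ?_
    rw [← Set.image_univ]
    exact convex_univ.affine_image gL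
  refine ⟨W, gL, hiso, hsub, ?_, ?_, ?_⟩
  · have := hi.finrank_vectorSpan (n := 2) (by simp [hc])
    rw [Subtype.range_coe_subtype] at this
    exact this
  · exact hiso.isClosedEmbedding.isCompact_preimage (solid_compact t)
  · have hconv : Convex ℝ (gL ⁻¹' solid t) := (convex_convexHull ℝ _).affine_preimage gL
    have hne : (interior (gL ⁻¹' solid t)).Nonempty := by
      rw [hconv.interior_nonempty_iff_affineSpan_eq_top]
      have h0 : (0 : W) ∈ gL ⁻¹' solid t := by
        change gL 0 ∈ solid t
        rw [hg, Submodule.coe_zero, zero_add]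
        exact subset_convexHull ℝ _ hp'
      rw [AffineSubspace.affineSpan_eq_top_iff_vectorSpan_eq_top_of_nonempty ℝ W W ⟨0, h0⟩]
      rw [eq_top_iff]
      rintro ⟨w, hw⟩ -
      have key : W ≤ (vectorSpan ℝ (gL ⁻¹' solid t)).map W.subtype := by
        conv_lhs => rw [hW, vectorSpan_eq_span_vsub_set_right ℝ hp']
        rw [Submodule.span_le]
        rintro _ ⟨x, hx, rfl⟩
        have hxW : x - p ∈ W := vsub_mem_vectorSpan ℝ hx hp'
        refine ⟨⟨x - p, hxW⟩, ?_, rfl⟩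
        have hx1 : (⟨x - p, hxW⟩ : W) ∈ gL ⁻¹' solid t := by
          change gL _ ∈ solid t
          rw [hg, sub_add_cancel]
          exact subset_convexHull ℝ _ hx
        have := vsub_mem_vectorSpan ℝ hx1 h0
        simpa using this
      obtain ⟨w', hw', hww⟩ := key hw
      have : w' = ⟨w, hw⟩ := Subtype.ext hww
      exact this ▸ hw'
    rw [hconv.closure_interior_eq_closure_of_nonempty_interior hne]
    exact subset_closure

lemma solid_area_lt_top {t : Finset R3} (hc : t.card = 3)
    (hi : AffineIndependent ℝ ((↑) : t → R3)) :
    (Measure.euclideanHausdorffMeasure 2 : Measure R3) (solid t) < ⊤ := by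
  obtain ⟨W, g, hg, hsub, hW, hcpt, -⟩ := exists_chart hc hi
  have h1 := hg.euclideanHausdorffMeasure_image (d := 2) (g ⁻¹' solid t)
  rw [Set.image_preimage_eq_of_subset hsub] at h1
  rw [h1, ← hW, InnerProductSpace.euclideanHausdorffMeasure_eq_volume]
  exact hcpt.measure_lt_top

lemma points_area_lt_top (S : TriangulatedSurface) :
    (Measure.euclideanHausdorffMeasure 2 : Measure R3) S.points < ⊤ := by
  refine (measure_biUnion_finset_le _ _).trans_lt ?_
  exact ENNReal.sum_lt_top.2 fun t ht => solid_area_lt_top (S.card_of_mem ht) (S.indep_of_mem ht)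

instance (S : TriangulatedSurface) : IsFiniteMeasure (area S.points) :=
  ⟨by simpa [area] using points_area_lt_top S⟩

lemma eqOn_zero_of_ae {t : Finset R3} (hc : t.card = 3)
    (hi : AffineIndependent ℝ ((↑) : t → R3)) {u : R3 → ℝ} (hu : ContinuousOn u (solid t))
    (h : u =ᵐ[area (solid t)] 0) : Set.EqOn u 0 (solid t) := by
  obtain ⟨W, g, hg, hsub, hW, hcpt, hcl⟩ := exists_chart hc hi
  have hmeas : MeasurableSet (solid t) := (solid_compact t).measurableSet
  have hgm : MeasurableEmbedding g := hg.isClosedEmbedding.measurableEmbedding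
  have h1 : area (solid t) = ((volume : Measure W).restrict (g ⁻¹' solid t)).map g := by
    rw [← Measure.restrict_map hgm.measurable hmeas]
    have h2 := hg.map_euclideanHausdorffMeasure (d := 2)
    rw [← hW, InnerProductSpace.euclideanHausdorffMeasure_eq_volume, hW] at h2
    rw [h2, Measure.restrict_restrict hmeas, Set.inter_eq_left.2 hsub]
    rfl
  rw [h1] at h
  have h3 : (fun w => u (g w)) =ᵐ[(volume : Measure W).restrict (g ⁻¹' solid t)] fun _ => 0 :=
    ae_of_ae_map hgm.measurable.aemeasurable h
  have h4 := Measure.eqOn_of_ae_eq h3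
    (hu.comp hg.continuous.continuousOn (fun w hw => hw)) continuousOn_const hcl
  intro x hx
  obtain ⟨w, rfl⟩ := hsub hx
  exact h4 hx

lemma integrable_of_continuousOn {S : TriangulatedSurface} {f : R3 → ℝ}
    (hf : ContinuousOn f S.points) : Integrable f (area S.points) :=
  hf.integrableOn_of_subset_isCompact (points_compact S) (points_compact S).measurableSet
    subset_rfl (points_area_lt_top S).ne

/-! ### The finite element space -/

/-- Continuous piecewise linear functions on the surface, subject to the constraints of the energy
space: they vanish on the boundary if there is one, and they have mean value zero if there is no
boundary and the coefficient `b` vanishes almost everywhere. A function on the surface is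
represented by its extension by zero to `ℝ³`. -/
def feSubmodule (S : TriangulatedSurface) (c : Coefficients S) : Submodule ℝ (R3 → ℝ) where
  carrier := {u | (∀ x ∉ S.points, u x = 0) ∧ ContinuousOn u S.points ∧
    (∀ t ∈ S.triangles, ∃ A : R3 →ᵃ[ℝ] ℝ, Set.EqOn u A (solid t)) ∧
    (S.boundary.Nonempty → ∀ x ∈ S.boundary, u x = 0) ∧
    (S.boundary = ∅ → (∀ᵐ x ∂(area S.points), c.b x = 0) → ∫ x, u x ∂(area S.points) = 0)}
  zero_mem' := ⟨fun _ _ => rfl, continuousOn_const, fun _ _ => ⟨0, fun _ _ => rfl⟩,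
    fun _ _ _ => rfl, fun _ _ => by simp⟩
  add_mem' := by
    rintro u v ⟨hu1, hu2, hu3, hu4, hu5⟩ ⟨hv1, hv2, hv3, hv4, hv5⟩
    refine ⟨fun x hx => ?_, hu2.add hv2, fun t ht => ?_, fun hb x hx => ?_, fun hb hc => ?_⟩
    · simp [hu1 x hx, hv1 x hx]
    · obtain ⟨A, hA⟩ := hu3 t ht
      obtain ⟨B, hB⟩ := hv3 t ht
      exact ⟨A + B, fun x hx => by simp [hA hx, hB hx]⟩
    · simp [hu4 hb x hx, hv4 hb x hx]
    · simp only [Pi.add_apply]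
      rw [integral_add (integrable_of_continuousOn hu2) (integrable_of_continuousOn hv2),
        hu5 hb hc, hv5 hb hc, add_zero]
  smul_mem' := by
    rintro r u ⟨hu1, hu2, hu3, hu4, hu5⟩
    refine ⟨fun x hx => ?_, hu2.const_smul r, fun t ht => ?_, fun hb x hx => ?_, fun hb hc => ?_⟩
    · simp [hu1 x hx]
    · obtain ⟨A, hA⟩ := hu3 t ht
      exact ⟨r • A, fun x hx => by simp [hA hx]⟩
    · simp [hu4 hb x hx]
    · simp only [Pi.smul_apply, smul_eq_mul]
      rw [integral_const_mul, hu5 hb hc, mul_zero]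

/-- The finite element space `V_h`. It carries the inner product of `L²(M_h)` (see below). -/
def FESpace (S : TriangulatedSurface) (c : Coefficients S) : Type := feSubmodule S c

variable {S : TriangulatedSurface} {c : Coefficients S}

instance : AddCommGroup (FESpace S c) := inferInstanceAs (AddCommGroup (feSubmodule S c))
instance : Module ℝ (FESpace S c) := inferInstanceAs (Module ℝ (feSubmodule S c))

/-- The function on the surface (extended by zero) represented by an element of `V_h`. -/
def FESpace.toFun (u : FESpace S c) : R3 → ℝ := (show feSubmodule S c from u).1

@[simp] lemma FESpace.toFun_add (u v : FESpace S c) : (u + v).toFun = u.toFun + v.toFun := rfl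
@[simp] lemma FESpace.toFun_smul (r : ℝ) (u : FESpace S c) : (r • u).toFun = r • u.toFun := rfl

lemma FESpace.ext {u v : FESpace S c} (h : u.toFun = v.toFun) : u = v := Subtype.ext h

lemma FESpace.zero_off (u : FESpace S c) {x : R3} (hx : x ∉ S.points) : u.toFun x = 0 :=
  (show feSubmodule S c from u).2.1 x hx

lemma FESpace.continuousOn (u : FESpace S c) : ContinuousOn u.toFun S.points :=
  (show feSubmodule S c from u).2.2.1

lemma FESpace.affine (u : FESpace S c) {t : Finset R3} (ht : t ∈ S.triangles) :
    ∃ A : R3 →ᵃ[ℝ] ℝ, Set.EqOn u.toFun A (solid t) :=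
  (show feSubmodule S c from u).2.2.2.1 t ht

lemma FESpace.eq_zero {u : FESpace S c} (h : ∀ t ∈ S.triangles, Set.EqOn u.toFun 0 (solid t)) :
    u = 0 := by
  refine FESpace.ext (funext fun x => ?_)
  change u.toFun x = 0
  by_cases hx : x ∈ S.points
  · obtain ⟨t, ht, hxt⟩ := Set.mem_iUnion₂.1 hx
    exact h t ht hxt
  · exact u.zero_off hx

lemma FESpace.integrable_mul (u v : FESpace S c) :
    Integrable (fun x => u.toFun x * v.toFun x) (area S.points) :=
  integrable_of_continuousOn (u.continuousOn.mul v.continuousOn)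

/-- The inner product `∫_{M_h} u v` of `L²(M_h)` on `V_h`. -/
@[reducible] def innerCore (S : TriangulatedSurface) (c : Coefficients S) :
    InnerProductSpace.Core ℝ (FESpace S c) where
  inner u v := ∫ x, u.toFun x * v.toFun x ∂(area S.points)
  conj_inner_symm u v := by simp [mul_comm]
  re_inner_nonneg u := by
    simpa using integral_nonneg (fun x => mul_self_nonneg (u.toFun x))
  add_left u v w := by
    simp only [FESpace.toFun_add, Pi.add_apply, add_mul]
    exact integral_add (u.integrable_mul w) (v.integrable_mul w)
  smul_left u v r := by
    simp only [FESpace.toFun_smul, Pi.smul_apply, smul_eq_mul, mul_assoc]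
    exact integral_const_mul _ _
  definite u hu := by
    have h := (integral_eq_zero_iff_of_nonneg (fun x => mul_self_nonneg (u.toFun x))
      (u.integrable_mul u)).1 hu
    refine FESpace.eq_zero fun t ht => ?_
    refine eqOn_zero_of_ae (S.card_of_mem ht) (S.indep_of_mem ht)
      (u.continuousOn.mono (solid_subset_points ht)) ?_
    have h' := ae_restrict_of_ae_restrict_of_subset (solid_subset_points ht) h
    filter_upwards [h'] with x hx
    exact mul_self_eq_zero.1 hx

instance : NormedAddCommGroup (FESpace S c) :=
  @InnerProductSpace.Core.toNormedAddCommGroup ℝ (FESpace S c) _ _ _ (innerCore S c)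

instance : InnerProductSpace ℝ (FESpace S c) := InnerProductSpace.ofCore (innerCore S c).toCore

lemma FESpace.inner_def (u v : FESpace S c) :
    inner ℝ u v = ∫ x, u.toFun x * v.toFun x ∂(area S.points) := rfl

instance : FiniteDimensional ℝ (FESpace S c) := by
  let N : Finset R3 := S.triangles.biUnion id
  let F : FESpace S c →ₗ[ℝ] (N → ℝ) :=
    { toFun := fun u n => u.toFun n
      map_add' := fun _ _ => rfl
      map_smul' := fun _ _ => rfl }
  refine FiniteDimensional.of_injective F ?_
  rw [← LinearMap.ker_eq_bot, LinearMap.ker_eq_bot']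
  intro u hu
  refine FESpace.eq_zero fun t ht => ?_
  obtain ⟨A, hA⟩ := u.affine ht
  have hvert : ∀ x ∈ (t : Set R3), x ∈ A ⁻¹' {0} := by
    intro x hx
    have hxN : x ∈ N := Finset.mem_biUnion.2 ⟨t, ht, hx⟩
    have h0 : u.toFun x = 0 := congrFun hu ⟨x, hxN⟩
    rw [hA (subset_convexHull ℝ _ hx)] at h0
    exact h0
  have hall : solid t ⊆ A ⁻¹' {0} :=
    convexHull_min hvert ((convex_singleton 0).affine_preimage A)
  intro x hx
  rw [hA hx]
  exact hall hx

/-! ### The discrete elliptic operator -/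

/-- `g` is the tangential gradient on the triangle `t` of the function `u`, affine on `t`. -/
def IsSurfaceGradient (t : Finset R3) (u : R3 → ℝ) (g : R3) : Prop :=
  g ∈ vectorSpan ℝ (t : Set R3) ∧
    ∀ x ∈ solid t, ∀ y ∈ solid t, u y - u x = inner ℝ g (y - x)

/-- The (constant) tangential gradient of `u` on the triangle `t`. -/
def surfaceGradient (t : Finset R3) (u : R3 → ℝ) : R3 :=
  Classical.epsilon (IsSurfaceGradient t u)

lemma IsSurfaceGradient.unique {t : Finset R3} {u : R3 → ℝ} {g g' : R3}
    (h : IsSurfaceGradient t u g) (h' : IsSurfaceGradient t u g') : g = g' := by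
  have hmem : g - g' ∈ vectorSpan ℝ (t : Set R3) := Submodule.sub_mem _ h.1 h'.1
  have horth : ∀ w ∈ vectorSpan ℝ (t : Set R3), inner ℝ (g - g') w = 0 := by
    intro w hw
    rw [vectorSpan_def] at hw
    induction hw using Submodule.span_induction with
    | mem w hw =>
      obtain ⟨y, hy, x, hx, rfl⟩ := hw
      have h1 := h.2 x (subset_convexHull ℝ _ hx) y (subset_convexHull ℝ _ hy)
      have h2 := h'.2 x (subset_convexHull ℝ _ hx) y (subset_convexHull ℝ _ hy)
      simp only [vsub_eq_sub, inner_sub_left]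
      linarith
    | zero => simp
    | add x y _ _ hx hy => rw [inner_add_right, hx, hy, add_zero]
    | smul r x _ hx => rw [inner_smul_right, hx, mul_zero]
  exact sub_eq_zero.1 (inner_self_eq_zero.1 (horth _ hmem))

lemma surfaceGradient_spec (u : FESpace S c) {t : Finset R3} (ht : t ∈ S.triangles) :
    IsSurfaceGradient t u.toFun (surfaceGradient t u.toFun) := by
  refine Classical.epsilon_spec ?_
  obtain ⟨A, hA⟩ := u.affine ht
  set W := vectorSpan ℝ (t : Set R3)
  let g0 : R3 := (InnerProductSpace.toDual ℝ R3).symm (LinearMap.toContinuousLinearMap A.linear)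
  refine ⟨W.starProjection g0, W.starProjection_apply_mem g0, fun x hx y hy => ?_⟩
  have hyx : y - x ∈ W := by
    have h1 : solid t ⊆ affineSpan ℝ (t : Set R3) := convexHull_subset_affineSpan _
    have := AffineSubspace.vsub_mem_direction (h1 hy) (h1 hx)
    rwa [direction_affineSpan] at this
  rw [Submodule.inner_starProjection_left_eq_right, Submodule.starProjection_eq_self_iff.2 hyx,
    hA hx, hA hy, InnerProductSpace.toDual_symm_apply]
  simpa using (A.linearMap_vsub y x).symm

lemma surfaceGradient_add (u v : FESpace S c) {t : Finset R3} (ht : t ∈ S.triangles) :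
    surfaceGradient t (u + v).toFun = surfaceGradient t u.toFun + surfaceGradient t v.toFun := by
  have hu := surfaceGradient_spec u ht
  have hv := surfaceGradient_spec v ht
  refine (surfaceGradient_spec (u + v) ht).unique
    ⟨Submodule.add_mem _ hu.1 hv.1, fun x hx y hy => ?_⟩
  rw [inner_add_left, ← hu.2 x hx y hy, ← hv.2 x hx y hy]
  simp only [FESpace.toFun_add, Pi.add_apply]
  ring

lemma surfaceGradient_smul (r : ℝ) (u : FESpace S c) {t : Finset R3} (ht : t ∈ S.triangles) :
    surfaceGradient t (r • u).toFun = r • surfaceGradient t u.toFun := by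
  have hu := surfaceGradient_spec u ht
  refine (surfaceGradient_spec (r • u) ht).unique
    ⟨Submodule.smul_mem _ _ hu.1, fun x hx y hy => ?_⟩
  rw [real_inner_smul_left, ← hu.2 x hx y hy]
  simp only [FESpace.toFun_smul, Pi.smul_apply, smul_eq_mul]
  ring

/-- The energy `∫_{M_h} a ∇u · ∇v + b u v`, as a sum over the triangles. -/
def energy (S : TriangulatedSurface) (c : Coefficients S) (u v : FESpace S c) : ℝ :=
  ∑ t ∈ S.triangles, ∫ x, (c.a x * inner ℝ (surfaceGradient t u.toFun) (surfaceGradient t v.toFun)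
    + c.b x * u.toFun x * v.toFun x) ∂(area (solid t))

lemma Coefficients.integrable_a (c : Coefficients S) : Integrable c.a (area S.points) := by
  obtain ⟨lo, hi, hlo, h⟩ := c.a_bounds
  refine Integrable.of_bound c.a_meas hi ?_
  filter_upwards [h] with x hx
  rw [Real.norm_of_nonneg (hlo.le.trans hx.1)]
  exact hx.2

lemma Coefficients.integrable_b (c : Coefficients S) (u v : FESpace S c) :
    Integrable (fun x => c.b x * u.toFun x * v.toFun x) (area S.points) := by
  obtain ⟨hi, h⟩ := c.b_bounds
  simp only [mul_assoc]
  refine (u.integrable_mul v).bdd_mul (c := hi) c.b_meas ?_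
  filter_upwards [h] with x hx
  rw [Real.norm_of_nonneg hx.1]
  exact hx.2

lemma integrable_energy (u v : FESpace S c) {t : Finset R3} (ht : t ∈ S.triangles) (r : ℝ) :
    Integrable (fun x => c.a x * r + c.b x * u.toFun x * v.toFun x) (area (solid t)) :=
  ((c.integrable_a.mul_const r).add (c.integrable_b u v)).mono_measure
    (Measure.restrict_mono (solid_subset_points ht) le_rfl)

lemma energy_symm (u v : FESpace S c) : energy S c u v = energy S c v u := by
  refine Finset.sum_congr rfl fun t _ => integral_congr_ae (Filter.Eventually.of_forall fun x => ?_)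
  simp only [real_inner_comm (surfaceGradient t u.toFun)]
  ring

lemma energy_add (u u' v : FESpace S c) :
    energy S c (u + u') v = energy S c u v + energy S c u' v := by
  simp only [energy]
  rw [← Finset.sum_add_distrib]
  refine Finset.sum_congr rfl fun t ht => ?_
  rw [← integral_add (integrable_energy u v ht _) (integrable_energy u' v ht _)]
  refine integral_congr_ae (Filter.Eventually.of_forall fun x => ?_)
  rw [surfaceGradient_add u u' ht, inner_add_left, FESpace.toFun_add]
  simp only [Pi.add_apply]
  ring

lemma energy_smul (r : ℝ) (u v : FESpace S c) :
    energy S c (r • u) v = r * energy S c u v := by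
  simp only [energy]
  rw [Finset.mul_sum]
  refine Finset.sum_congr rfl fun t ht => ?_
  rw [← integral_const_mul]
  refine integral_congr_ae (Filter.Eventually.of_forall fun x => ?_)
  rw [surfaceGradient_smul r u ht, real_inner_smul_left, FESpace.toFun_smul]
  simp only [Pi.smul_apply, smul_eq_mul]
  ring

/-- The energy as a bilinear form. -/
def energyForm (S : TriangulatedSurface) (c : Coefficients S) :
    FESpace S c →ₗ[ℝ] FESpace S c →ₗ[ℝ] ℝ :=
  LinearMap.mk₂ ℝ (energy S c) energy_add energy_smul
    (fun u v w => by
      rw [energy_symm, energy_add, energy_symm v, energy_symm w])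
    (fun r u v => by rw [energy_symm, energy_smul, energy_symm v]; rfl)

/-- The discrete elliptic operator `L_h` on `V_h`: the operator that represents the energy in the
inner product of `L²(M_h)`. -/
def discreteOperator (S : TriangulatedSurface) (c : Coefficients S) :
    FESpace S c →ₗ[ℝ] FESpace S c :=
  ∑ j, ((energyForm S c).flip (stdOrthonormalBasis ℝ (FESpace S c) j)).smulRight
    (stdOrthonormalBasis ℝ (FESpace S c) j)

/-- The defining relation `∫ (L_h w) v = ∫ a ∇w · ∇v + b w v`. -/
lemma inner_discreteOperator (w v : FESpace S c) :
    inner ℝ (discreteOperator S c w) v = energy S c w v := by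
  conv_rhs => rw [← (stdOrthonormalBasis ℝ (FESpace S c)).sum_repr' v]
  change _ = energyForm S c w _
  rw [map_sum]
  simp only [discreteOperator, LinearMap.sum_apply, LinearMap.smulRight_apply, sum_inner,
    LinearMap.flip_apply, real_inner_smul_left, map_smul, smul_eq_mul]
  exact Finset.sum_congr rfl fun j _ => mul_comm _ _

lemma discreteOperator_symmetric (S : TriangulatedSurface) (c : Coefficients S) :
    (discreteOperator S c).IsSymmetric := fun u v => by
  rw [inner_discreteOperator, energy_symm, ← inner_discreteOperator, real_inner_comm]

/-- The smallest eigenvalue of the discrete operator. -/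
def eigMin (S : TriangulatedSurface) (c : Coefficients S) : ℝ :=
  sInf {l : ℝ | Module.End.HasEigenvalue (discreteOperator S c) l}

/-- The largest eigenvalue of the discrete operator. -/
def eigMax (S : TriangulatedSurface) (c : Coefficients S) : ℝ :=
  sSup {l : ℝ | Module.End.HasEigenvalue (discreteOperator S c) l}

/-- The power `T ^ s` of a symmetric operator with positive eigenvalues, through an orthonormal
eigenbasis: `T ^ s v = ∑ j, λ_j ^ s (ψ_j, v) ψ_j`. -/
def spectralPower {V : Type*} [NormedAddCommGroup V] [InnerProductSpace ℝ V]
    [FiniteDimensional ℝ V] {T : V →ₗ[ℝ] V} (hT : T.IsSymmetric) (s : ℝ) (v : V) : V :=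
  ∑ j, (hT.eigenvalues rfl j ^ s * inner ℝ (hT.eigenvectorBasis rfl j) v) •
    hT.eigenvectorBasis rfl j

/-! ### Padé approximation and the product scheme -/

/-- `P / Q` is the diagonal Padé approximant of type `(m, m)` of `(1 + t) ^ (-α)`, normalized by
`Q(0) = 1`: the Maclaurin coefficients of `P / Q` and of `(1 + t) ^ (-α)` agree up to `t ^ (2m)`,
those of the latter being `(-α)(-α-1)⋯(-α-k+1) / k!`. -/
def IsPade (α : ℝ) (m : ℕ) (P Q : ℝ[X]) : Prop :=
  P.natDegree ≤ m ∧ Q.natDegree ≤ m ∧ Q.coeff 0 = 1 ∧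
    ∀ k ≤ 2 * m, PowerSeries.coeff k ((P : PowerSeries ℝ) * (Q : PowerSeries ℝ)⁻¹) =
      (∏ i ∈ Finset.range k, (-α - i)) / (Nat.factorial k : ℝ)

/-- The mesh size `τ_n = t_{n+1} - t_n`. -/
def step (t : ℕ → ℝ) (n : ℕ) : ℝ := t (n + 1) - t n

/-- `θ_n(λ) = τ_n (λ - λ̂) / (λ̂ + t_n (λ - λ̂))`. -/
def theta (lhat : ℝ) (t : ℕ → ℝ) (n : ℕ) (l : ℝ) : ℝ :=
  step t n * (l - lhat) / (lhat + t n * (l - lhat))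

/-- The scalar recurrence `μ_0 = λ̂ ^ (-α)`, `μ_{n+1} = r(θ_n) μ_n` with `r = P / Q`. -/
def mu (P Q : ℝ[X]) (α lhat : ℝ) (t : ℕ → ℝ) (l : ℝ) : ℕ → ℝ
  | 0 => lhat ^ (-α)
  | n + 1 => P.eval (theta lhat t n l) / Q.eval (theta lhat t n l) * mu P Q α lhat t l n

/-- The constant `c'_α = α π / (2 Γ(1 - α) Γ(1 + α))`. -/
def cPrime (α : ℝ) : ℝ := α * Real.pi / (2 * Real.Gamma (1 - α) * Real.Gamma (1 + α))

/-- The constant `c̃ = (α + ν) 2 ^ α c'_α / α`. -/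
def cTilde (α ν : ℝ) : ℝ := (α + ν) * (2 : ℝ) ^ α * (cPrime α / α)

section Scheme

variable {V : Type*} [AddCommGroup V] [Module ℝ V]

/-- `λ̂ I + t_n B` with `B = T - λ̂ I`. -/
def shifted (T : Module.End ℝ V) (lhat : ℝ) (t : ℕ → ℝ) (n : ℕ) : Module.End ℝ V :=
  lhat • 1 + t n • (T - lhat • 1)

/-- `τ_n B (λ̂ I + t_n B)⁻¹` with `B = T - λ̂ I`. (`Ring.inverse` is the inverse of an invertible
operator.) -/
def thetaOp (T : Module.End ℝ V) (lhat : ℝ) (t : ℕ → ℝ) (n : ℕ) : Module.End ℝ V :=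
  (step t n • (T - lhat • 1)) * Ring.inverse (shifted T lhat t n)

/-- The product scheme `U_0 = λ̂ ^ (-α) f`, `U_{n+1} = r(τ_n B (λ̂ I + t_n B)⁻¹) U_n`, where
`r = P / Q` and `r(X) = P(X) Q(X)⁻¹`. -/
def scheme (P Q : ℝ[X]) (α : ℝ) (T : Module.End ℝ V) (lhat : ℝ) (t : ℕ → ℝ) (f : V) : ℕ → V
  | 0 => lhat ^ (-α) • f
  | n + 1 => (aeval (thetaOp T lhat t n) P * Ring.inverse (aeval (thetaOp T lhat t n) Q))
      (scheme P Q α T lhat t f n)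

end Scheme

end PadeFEM

end

open PadeFEM

/-!
Write `f(t) = (1 + t) ^ (-α)` and `r = P / Q` for its diagonal Padé approximant of degree `m`.

*The Padé pair.* `P` and `Q` are the hypergeometric polynomials `₂F₁(-m, -m ± α; -2m; -t)`
(`padePoly`). Their differential equations show that `(1 + t)(P' Q - P Q') + α P Q` is a monomial
`κ t ^ (2m)` (`residual_padePoly`). Since `f` solves `(1 + t) f' + α f = 0`, this gives the order of
contact (`isPade_padePoly`), the coprimality of `P` and `Q` and hence uniqueness
(`IsPade.eq_padePoly`), and the exact error formula
`((1 + t) ^ α r)' = κ t ^ (2m) (1 + t) ^ (α - 1) / Q ^ 2` (`hasDerivAt_pade`).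

*The local error.* The denominators satisfy a three-term recurrence (`padePoly_three_term`) with
limiting characteristic roots `((√(1 + t) ± 1) / 2) ^ 2`. With `X` the larger root, it yields
`X ^ (2m) (1 + t) ^ (α - 1/2) ≤ Q ^ 2` on `[0, 1]` (`growth_pow_mul_rpow_le`). Put into the error
formula, this bound makes the right-hand side at most the derivative of
`16 ^ m κ / (2m + 1) * t * q ^ (2m)`, where `q = (√(1 + t) - 1) / (√(1 + t) + 1)`, and
`q ^ 2 ≤ 17 - 12 √2 ≤ 1 / 32` on `[0, 1]`. The constant `16 ^ m κ / (2m + 1)` tends to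
`sin(πα) / 2 = c'_α` by Euler's sine product and is at most `2 ^ α c'_α` (`errorConst_le`). Altogether
`|f(t) - r(t)| ≤ 2 ^ α c'_α 2 ^ (-5m) t` on `[0, 1]` (`pade_error`).

*Summation.* As `1 + θ_n` is the quotient of consecutive values of `λ̂ + t_n (λ - λ̂)`, the product of
the `f(θ_n)` telescopes to `(λ / λ̂) ^ (-α)`. Since `0 < r ≤ 1`, local errors are not amplified. Their
sum is compared with a telescoping sum, the first term by `θ_0 ≤ 1` and the others by shifting the
index at the expense of the factor `ν` (`abs_rpow_sub_mu_le`). This gives the scalar estimate, and the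
operator estimate follows in an orthonormal eigenbasis of the discrete operator, where the scheme is
the scalar recurrence in each component (`scheme_eq_sum`).
-/

namespace PadeFEM

/-! ### The explicit Padé polynomials -/

/-- The coefficient `(m choose k) (m + β)(m + β - 1)⋯(m + β - k + 1) / (2m)(2m - 1)⋯(2m - k + 1)`
of `t ^ k` in `₂F₁(-m, -m - β; -2m; -t)`, written as a product of ratios of consecutive
coefficients. -/
noncomputable def padeCoeff (β : ℝ) (m k : ℕ) : ℝ :=
  ∏ i ∈ Finset.range k, ((m - i : ℝ) * (m + β - i)) / ((i + 1) * (2 * m - i))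

/-- The polynomial `₂F₁(-m, -m - β; -2m; -t)`. The Padé approximant of `(1 + t) ^ (-α)` has the
denominator `padePoly α m` and the numerator `padePoly (-α) m`. -/
noncomputable def padePoly (β : ℝ) (m : ℕ) : ℝ[X] :=
  ∑ k ∈ Finset.range (m + 1), C (padeCoeff β m k) * X ^ k

lemma padeCoeff_zero (β : ℝ) (m : ℕ) : padeCoeff β m 0 = 1 := by simp [padeCoeff]

lemma padeCoeff_succ (β : ℝ) (m k : ℕ) :
    padeCoeff β m (k + 1) =
      padeCoeff β m k * (((m - k : ℝ) * (m + β - k)) / ((k + 1) * (2 * m - k))) :=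
  Finset.prod_range_succ _ _

lemma padeCoeff_eq_zero (β : ℝ) {m k : ℕ} (h : m < k) : padeCoeff β m k = 0 :=
  Finset.prod_eq_zero (Finset.mem_range.2 h) (by simp)

lemma padeCoeff_pos {β : ℝ} (hβ : -1 < β) {m k : ℕ} (h : k ≤ m) : 0 < padeCoeff β m k := by
  refine Finset.prod_pos fun i hi => ?_
  have hi' : i + 1 ≤ m := (Finset.mem_range.1 hi).trans_le h
  have : (i : ℝ) + 1 ≤ m := by exact_mod_cast hi'
  have h0 : (0 : ℝ) ≤ i := i.cast_nonneg
  refine div_pos (mul_pos ?_ ?_) (mul_pos ?_ ?_) <;> linarith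

lemma padeCoeff_nonneg {β : ℝ} (hβ : -1 < β) (m k : ℕ) : 0 ≤ padeCoeff β m k := by
  rcases le_or_gt k m with h | h
  · exact (padeCoeff_pos hβ h).le
  · exact (padeCoeff_eq_zero β h).ge

lemma padeCoeff_le {β γ : ℝ} (hβ : -1 < β) (h : β ≤ γ) (m k : ℕ) :
    padeCoeff β m k ≤ padeCoeff γ m k := by
  rcases le_or_gt k m with hk | hk
  · refine Finset.prod_le_prod (fun i hi => ?_) (fun i hi => ?_)
    all_goals
      have hi' : i + 1 ≤ m := (Finset.mem_range.1 hi).trans_le hk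
      have : (i : ℝ) + 1 ≤ m := by exact_mod_cast hi'
      have h0 : (0 : ℝ) ≤ i := i.cast_nonneg
    · refine div_nonneg (mul_nonneg ?_ ?_) (mul_nonneg ?_ ?_) <;> linarith
    · refine div_le_div_of_nonneg_right (mul_le_mul_of_nonneg_left ?_ ?_)
        (mul_nonneg ?_ ?_) <;> linarith
  · rw [padeCoeff_eq_zero β hk, padeCoeff_eq_zero γ hk]

lemma coeff_padePoly (β : ℝ) (m k : ℕ) : (padePoly β m).coeff k = padeCoeff β m k := by
  simp only [padePoly, finsetSum_coeff, coeff_C_mul_X_pow]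
  rw [Finset.sum_ite_eq]
  split_ifs with h
  · rfl
  · exact (padeCoeff_eq_zero β (by simpa using h)).symm

lemma natDegree_padePoly_le (β : ℝ) (m : ℕ) : (padePoly β m).natDegree ≤ m :=
  natDegree_le_iff_coeff_eq_zero.2 fun k hk => by
    rw [coeff_padePoly, padeCoeff_eq_zero β hk]

lemma natDegree_padePoly {β : ℝ} (hβ : -1 < β) (m : ℕ) : (padePoly β m).natDegree = m :=
  le_antisymm (natDegree_padePoly_le β m) <| le_natDegree_of_ne_zero <| by
    rw [coeff_padePoly]; exact (padeCoeff_pos hβ le_rfl).ne'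

lemma padeCoeff_rec (β : ℝ) {m : ℕ} (hm : 1 ≤ m) (k : ℕ) :
    (k + 1 : ℝ) * (2 * m - k) * padeCoeff β m (k + 1) =
      (m - k : ℝ) * (m + β - k) * padeCoeff β m k := by
  rcases le_or_gt k m with h | h
  · have h1 : (k : ℝ) ≤ m := by exact_mod_cast h
    have h2 : (1 : ℝ) ≤ m := by exact_mod_cast hm
    have h3 : (2 * m - k : ℝ) ≠ 0 := by linarith
    have h4 : (k + 1 : ℝ) ≠ 0 := by positivity
    rw [padeCoeff_succ]
    field_simp
  · rw [padeCoeff_eq_zero β h, padeCoeff_eq_zero β (h.trans k.lt_succ_self)]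
    simp

/-- The hypergeometric differential equation of the Padé polynomials. -/
lemma padePoly_ode (β : ℝ) {m : ℕ} (hm : 1 ≤ m) :
    X * derivative (derivative (padePoly β m)) + X ^ 2 * derivative (derivative (padePoly β m)) +
      C (1 - 2 * m - β) * (X * derivative (padePoly β m)) -
      C (2 * m : ℝ) * derivative (padePoly β m) + C (m * (m + β)) * padePoly β m = 0 := by
  ext k
  have h := padeCoeff_rec β hm k
  rcases k with - | - | k
  · simp only [coeff_add, coeff_sub, mul_coeff_zero, coeff_X_zero, coeff_derivative,
      coeff_padePoly, coeff_zero, coeff_X_pow] at h ⊢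
    push_cast at h ⊢
    norm_num at h ⊢
    linarith
  · simp only [coeff_add, coeff_sub, coeff_C_mul, coeff_X_mul, coeff_derivative, pow_two, mul_assoc,
      mul_coeff_zero, coeff_X_zero, coeff_padePoly, coeff_zero] at h ⊢
    push_cast at h ⊢
    norm_num at h ⊢
    linarith
  · simp only [coeff_add, coeff_sub, coeff_C_mul, coeff_X_mul, coeff_derivative, pow_two, mul_assoc,
      coeff_padePoly, coeff_zero] at h ⊢
    push_cast at h ⊢
    linarith

/-- The residual `(1 + t)(P' Q - P Q') + α P Q`. It is `Q ^ 2` times the defect of `r = P / Q` in the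
differential equation `(1 + t) r' + α r = 0` of `(1 + t) ^ (-α)`. -/
noncomputable def residual (α : ℝ) (P Q : ℝ[X]) : ℝ[X] :=
  (1 + X) * (derivative P * Q - P * derivative Q) + C α * (P * Q)

/-- The leading coefficient of the residual of the Padé approximant. -/
noncomputable def padeKappa (α : ℝ) (m : ℕ) : ℝ := α * (padeCoeff (-α) m m * padeCoeff α m m)

lemma X_mul_derivative_residual (α : ℝ) {m : ℕ} (hm : 1 ≤ m) :
    X * derivative (residual α (padePoly (-α) m) (padePoly α m)) =
      C (2 * m : ℝ) * residual α (padePoly (-α) m) (padePoly α m) := by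
  have hP := padePoly_ode (-α) hm
  have hQ := padePoly_ode α hm
  set P := padePoly (-α) m
  set Q := padePoly α m
  simp only [residual, derivative_add, derivative_mul, derivative_sub, derivative_one,
    derivative_X, derivative_C]
  simp only [map_sub, map_add, map_mul, map_neg, map_one, map_natCast, map_ofNat] at hP hQ ⊢
  linear_combination Q * hP - P * hQ

lemma residual_padePoly (α : ℝ) {m : ℕ} (hm : 1 ≤ m) :
    residual α (padePoly (-α) m) (padePoly α m) = C (padeKappa α m) * X ^ (2 * m) := by
  ext k
  rw [coeff_C_mul_X_pow]
  split_ifs with hk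
  · subst hk
    obtain ⟨n, rfl⟩ : ∃ n, m = n + 1 := ⟨m - 1, by omega⟩
    set m := n + 1 with hmn
    set P := padePoly (-α) m with hPdef
    set Q := padePoly α m with hQdef
    have hP : P.natDegree ≤ m := natDegree_padePoly_le _ _
    have hQ : Q.natDegree ≤ m := natDegree_padePoly_le _ _
    have hP' : (derivative P).natDegree ≤ n := (natDegree_derivative_le P).trans (by omega)
    have hQ' : (derivative Q).natDegree ≤ n := (natDegree_derivative_le Q).trans (by omega)
    have h1 : (derivative P * Q).coeff (2 * m) = 0 :=
      coeff_eq_zero_of_natDegree_lt (natDegree_mul_le.trans_lt (by omega))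
    have h2 : (P * derivative Q).coeff (2 * m) = 0 :=
      coeff_eq_zero_of_natDegree_lt (natDegree_mul_le.trans_lt (by omega))
    have h3 : (X * (derivative P * Q)).coeff (2 * m) = (m : ℝ) * (P.coeff m * Q.coeff m) := by
      rw [show 2 * m = (n + m) + 1 by omega, coeff_X_mul,
        coeff_mul_add_eq_of_natDegree_le hP' hQ, coeff_derivative, hmn]
      push_cast; ring
    have h4 : (X * (P * derivative Q)).coeff (2 * m) = (m : ℝ) * (P.coeff m * Q.coeff m) := by
      rw [show 2 * m = (m + n) + 1 by omega, coeff_X_mul,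
        coeff_mul_add_eq_of_natDegree_le hP hQ', coeff_derivative, hmn]
      push_cast; ring
    have h5 : (P * Q).coeff (2 * m) = P.coeff m * Q.coeff m := by
      rw [two_mul, coeff_mul_add_eq_of_natDegree_le hP hQ]
    rw [residual, add_mul, one_mul, mul_sub, coeff_add, coeff_add, coeff_sub, coeff_sub, h1, h2, h3,
      h4, coeff_C_mul, h5, hPdef, hQdef, coeff_padePoly, coeff_padePoly, padeKappa]
    ring
  · have h := congrArg (fun p => p.coeff k) (X_mul_derivative_residual α hm)
    simp only [coeff_C_mul] at h
    have h' : (X * derivative (residual α (padePoly (-α) m) (padePoly α m))).coeff k =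
        k * (residual α (padePoly (-α) m) (padePoly α m)).coeff k := by
      rcases k with - | k
      · simp
      · rw [coeff_X_mul, coeff_derivative]; push_cast; ring
    rw [h'] at h
    have hne : (k : ℝ) - 2 * m ≠ 0 := by
      intro h0
      exact hk (by exact_mod_cast sub_eq_zero.1 h0)
    refine (mul_eq_zero.1 (?_ : ((k : ℝ) - 2 * m) * _ = 0)).resolve_left hne
    linear_combination h

lemma padeKappa_pos {α : ℝ} (hα0 : 0 < α) (hα1 : α < 1) (m : ℕ) : 0 < padeKappa α m :=
  mul_pos hα0 (mul_pos (padeCoeff_pos (by linarith) le_rfl) (padeCoeff_pos (by linarith) le_rfl))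

/-! ### Existence and uniqueness of the Padé approximant -/

/-- The polynomials `padePoly (-α) m` and `padePoly α m` form a Padé pair: since the residual is a
multiple of `X ^ (2m)`, the coefficients of the quotient satisfy the recurrence of the binomial
coefficients up to order `2m`. -/
lemma isPade_padePoly (α : ℝ) {m : ℕ} (hm : 1 ≤ m) :
    IsPade α m (padePoly (-α) m) (padePoly α m) := by
  have hres := residual_padePoly α hm
  have hQ0 : (padePoly α m).coeff 0 = 1 := by rw [coeff_padePoly, padeCoeff_zero]
  have hP0 : (padePoly (-α) m).coeff 0 = 1 := by rw [coeff_padePoly, padeCoeff_zero]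
  refine ⟨natDegree_padePoly_le _ _, natDegree_padePoly_le _ _, hQ0, ?_⟩
  set P := padePoly (-α) m
  set Q := padePoly α m
  have hc : PowerSeries.constantCoeff (Q : PowerSeries ℝ) ≠ 0 := by
    rw [Polynomial.constantCoeff_coe, hQ0]; exact one_ne_zero
  have hQi : (Q : PowerSeries ℝ) * (Q : PowerSeries ℝ)⁻¹ = 1 := PowerSeries.mul_inv_cancel _ hc
  set R : PowerSeries ℝ := (P : PowerSeries ℝ) * (Q : PowerSeries ℝ)⁻¹ with hR
  have hRQ : R * Q = P := by rw [hR, mul_assoc, mul_comm (_⁻¹), hQi, mul_one]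
  have hR0 : PowerSeries.coeff 0 R = 1 := by
    have := congrArg PowerSeries.constantCoeff hRQ
    rw [map_mul, Polynomial.constantCoeff_coe, Polynomial.constantCoeff_coe, hQ0, hP0,
      mul_one] at this
    simpa using this
  have hd := congrArg (PowerSeries.derivative ℝ) hRQ
  rw [Derivation.leibniz] at hd
  simp only [PowerSeries.derivative_coe, smul_eq_mul] at hd
  have hres' := congrArg (fun p : ℝ[X] => (p : PowerSeries ℝ)) hres
  simp only [residual, Polynomial.coe_add, Polynomial.coe_mul, Polynomial.coe_sub,
    Polynomial.coe_one, Polynomial.coe_X, Polynomial.coe_C, Polynomial.coe_pow] at hres'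
  have key : (1 + PowerSeries.X) * PowerSeries.derivative ℝ R + PowerSeries.C α * R =
      PowerSeries.X ^ (2 * m) * (PowerSeries.C (padeKappa α m) * (Q : PowerSeries ℝ)⁻¹ ^ 2) := by
    have h1 : ((1 + PowerSeries.X) * PowerSeries.derivative ℝ R + PowerSeries.C α * R) *
        (Q : PowerSeries ℝ) ^ 2 =
        PowerSeries.C (padeKappa α m) * PowerSeries.X ^ (2 * m) := by
      rw [← hres', ← hd, ← hRQ]
      ring
    calc _ = ((1 + PowerSeries.X) * PowerSeries.derivative ℝ R + PowerSeries.C α * R) *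
          (Q : PowerSeries ℝ) ^ 2 * (Q : PowerSeries ℝ)⁻¹ ^ 2 := by
            rw [mul_assoc, ← mul_pow, hQi, one_pow, mul_one]
      _ = _ := by rw [h1]; ring
  have hrec : ∀ k < 2 * m, (k + 1 : ℝ) * PowerSeries.coeff (k + 1) R =
      (-α - k) * PowerSeries.coeff k R := by
    intro k hk
    have h0 := PowerSeries.X_pow_dvd_iff.1 (Dvd.intro _ key.symm) k hk
    rw [add_mul, one_mul, map_add, map_add, PowerSeries.coeff_derivative,
      PowerSeries.coeff_C_mul] at h0
    have h1 : PowerSeries.coeff k (PowerSeries.X * PowerSeries.derivative ℝ R) =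
        k * PowerSeries.coeff k R := by
      rcases k with - | k
      · simp
      · rw [PowerSeries.coeff_succ_X_mul, PowerSeries.coeff_derivative]; push_cast; ring
    rw [h1] at h0
    linarith
  intro k
  induction k with
  | zero => intro _; simpa using hR0
  | succ k ih =>
    intro hk
    have h1 := hrec k (by omega)
    rw [ih (by omega)] at h1
    rw [Finset.prod_range_succ, Nat.factorial_succ]
    have h2 : (k + 1 : ℝ) ≠ 0 := by positivity
    have h3 : (Nat.factorial k : ℝ) ≠ 0 := by positivity
    push_cast
    rw [eq_div_iff (mul_ne_zero h2 h3), ← mul_assoc, mul_comm _ (k + 1 : ℝ), h1]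
    field_simp

/-- Two Padé pairs have the same quotient. -/
lemma IsPade.mul_eq_mul {α : ℝ} {m : ℕ} {P Q P' Q' : ℝ[X]} (h : IsPade α m P Q)
    (h' : IsPade α m P' Q') : P * Q' = P' * Q := by
  obtain ⟨hP, hQ, hQ0, hc⟩ := h
  obtain ⟨hP', hQ', hQ0', hc'⟩ := h'
  have hinv : ∀ q : ℝ[X], q.coeff 0 = 1 → (q : PowerSeries ℝ)⁻¹ * (q : PowerSeries ℝ) = 1 :=
    fun q hq => PowerSeries.inv_mul_cancel _ (by simp [Polynomial.constantCoeff_coe, hq])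
  have hdvd : (PowerSeries.X : PowerSeries ℝ) ^ (2 * m + 1) ∣
      (P : PowerSeries ℝ) * (Q : PowerSeries ℝ)⁻¹ - (P' : PowerSeries ℝ) * (Q' : PowerSeries ℝ)⁻¹ :=
    PowerSeries.X_pow_dvd_iff.2 fun k hk => by
      rw [map_sub, hc k (by omega), hc' k (by omega), sub_self]
  have hdvd2 : (PowerSeries.X : PowerSeries ℝ) ^ (2 * m + 1) ∣
      ((P * Q' - P' * Q : ℝ[X]) : PowerSeries ℝ) := by
    have := hdvd.mul_right ((Q : PowerSeries ℝ) * (Q' : PowerSeries ℝ))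
    convert this using 1
    rw [Polynomial.coe_sub, Polynomial.coe_mul, Polynomial.coe_mul]
    linear_combination -(P : PowerSeries ℝ) * Q' * hinv Q hQ0 + (P' : PowerSeries ℝ) * Q * hinv Q' hQ0'
  rw [← sub_eq_zero]
  ext k
  rw [coeff_zero]
  rcases lt_or_ge k (2 * m + 1) with hk | hk
  · rw [← Polynomial.coeff_coe]
    exact PowerSeries.X_pow_dvd_iff.1 hdvd2 k hk
  · refine coeff_eq_zero_of_natDegree_lt (lt_of_le_of_lt ?_ hk)
    refine (natDegree_sub_le _ _).trans (max_le ?_ ?_) <;> refine natDegree_mul_le.trans ?_ <;> omega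

lemma isCoprime_padePoly {α : ℝ} (hα0 : 0 < α) (hα1 : α < 1) {m : ℕ} (hm : 1 ≤ m) :
    IsCoprime (padePoly α m) (padePoly (-α) m) := by
  have hres := residual_padePoly α hm
  have hκ := (padeKappa_pos hα0 hα1 m).ne'
  have hX : IsCoprime (padePoly α m) (X ^ (2 * m)) := by
    refine IsCoprime.pow_right ((irreducible_X.coprime_iff_not_dvd.2 ?_).symm)
    rw [X_dvd_iff, coeff_padePoly, padeCoeff_zero]
    exact one_ne_zero
  have hX2 : IsCoprime (padePoly α m) (residual α (padePoly (-α) m) (padePoly α m)) := by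
    rw [hres]
    exact (isCoprime_mul_unit_left_right (isUnit_C.2 hκ.isUnit) _ _).2 hX
  obtain ⟨a, b, hab⟩ := hX2
  refine ⟨a + b * ((1 + X) * derivative (padePoly (-α) m) + C α * padePoly (-α) m),
    -b * (1 + X) * derivative (padePoly α m), ?_⟩
  simp only [residual] at hab
  linear_combination hab

lemma IsPade.eq_padePoly {α : ℝ} (hα0 : 0 < α) (hα1 : α < 1) {m : ℕ} (hm : 1 ≤ m) {P Q : ℝ[X]}
    (h : IsPade α m P Q) : P = padePoly (-α) m ∧ Q = padePoly α m := by
  have heq := h.mul_eq_mul (isPade_padePoly α hm)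
  have hQne : padePoly α m ≠ 0 := fun h0 => by
    have := coeff_padePoly α m 0
    rw [h0, padeCoeff_zero] at this
    simp at this
  have hdvd : padePoly α m ∣ Q :=
    (isCoprime_padePoly hα0 hα1 hm).dvd_of_dvd_mul_left ⟨P, by rw [← heq, mul_comm]⟩
  obtain ⟨u, hu⟩ := hdvd
  obtain ⟨hP, hQ, hQ0, -⟩ := h
  have hune : u ≠ 0 := by
    rintro rfl
    rw [hu, mul_zero] at hQ0
    simp at hQ0
  have hdeg : u.natDegree = 0 := by
    rw [hu, natDegree_mul hQne hune, natDegree_padePoly (by linarith)] at hQ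
    omega
  rw [eq_C_of_natDegree_eq_zero hdeg] at hu
  rw [hu, coeff_mul_C, coeff_padePoly, padeCoeff_zero, one_mul] at hQ0
  rw [hQ0, C_1, mul_one] at hu
  refine ⟨?_, hu⟩
  rw [hu] at heq
  exact mul_right_cancel₀ hQne heq

/-! ### The three-term recurrence -/

lemma padeCoeff_succ_succ (β : ℝ) {n j : ℕ} (hj : j ≤ n) :
    padeCoeff β (n + 1) (j + 1) = padeCoeff β n j *
      (((n + 1) * (n + 1 + β) * (2 * n + 1 - j)) / ((2 * n + 2) * (2 * n + 1) * (j + 1))) := by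
  induction j with
  | zero =>
    rw [padeCoeff_succ, padeCoeff_zero, padeCoeff_zero]
    have h1 : (2 * n + 1 : ℝ) ≠ 0 := by positivity
    have h2 : (2 * n + 2 : ℝ) ≠ 0 := by positivity
    have h3 : (n + 1 : ℝ) ≠ 0 := by positivity
    push_cast
    simp only [sub_zero, zero_add, one_mul, mul_one]
    rw [show (2 * (n + 1) : ℝ) = 2 * n + 2 by ring]
    field_simp
  | succ j ih =>
    have h0 : (j + 1 : ℝ) ≤ n := by exact_mod_cast hj
    have hj0 : (0 : ℝ) ≤ j := j.cast_nonneg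
    rw [padeCoeff_succ, ih (by omega), padeCoeff_succ]
    have h1 : (2 * n + 1 : ℝ) ≠ 0 := by positivity
    have h2 : (2 * n + 2 : ℝ) ≠ 0 := by positivity
    have h3 : (j + 1 : ℝ) ≠ 0 := by positivity
    have h4 : (j + 1 + 1 : ℝ) ≠ 0 := by positivity
    have h5 : (2 * n - j : ℝ) ≠ 0 := by linarith
    have h6 : (2 * (n + 1) - (j + 1) : ℝ) ≠ 0 := by linarith
    push_cast
    rw [show (2 * n + 1 - (j + 1) : ℝ) = 2 * n - j by ring]
    obtain ⟨d, hd⟩ : ∃ d : ℝ, 2 * n - j = d := ⟨_, rfl⟩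
    obtain ⟨e, he⟩ : ∃ e : ℝ, 2 * (n + 1) - (j + 1) = e := ⟨_, rfl⟩
    rw [hd] at h5 ⊢
    rw [he] at h6 ⊢
    field_simp
    rw [← he]
    ring

/-- The three-term recurrence of the Padé polynomials, which come from the Jacobi polynomials with
parameters `(β, -β)`. -/
lemma padePoly_three_term (β : ℝ) (n : ℕ) :
    padePoly β (n + 2) = padePoly β (n + 1) + C (1 / 2) * (X * padePoly β (n + 1)) -
      C (((n + 1) ^ 2 - β ^ 2) / (4 * (2 * n + 1) * (2 * n + 3))) * (X ^ 2 * padePoly β n) := by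
  have h1 : (2 * n + 1 : ℝ) ≠ 0 := by positivity
  have h2 : (2 * n + 3 : ℝ) ≠ 0 := by positivity
  have h3 : (n + 1 : ℝ) ≠ 0 := by positivity
  have h4 : (n + 2 : ℝ) ≠ 0 := by positivity
  ext k
  rcases k with - | - | j
  · simp [coeff_padePoly, padeCoeff_zero]
  · simp only [coeff_add, coeff_sub, coeff_C_mul, coeff_X_mul, pow_two, mul_assoc, mul_coeff_zero,
      coeff_X_zero, coeff_padePoly, padeCoeff_succ, padeCoeff_zero]
    push_cast
    simp only [sub_zero, zero_add, one_mul, mul_one, mul_zero]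
    field_simp
    ring
  · simp only [coeff_add, coeff_sub, coeff_C_mul, coeff_X_mul, pow_two, mul_assoc, coeff_padePoly]
    rcases le_or_gt j n with hj | hj
    · have h0 : (j : ℝ) ≤ n := by exact_mod_cast hj
      have hj0 : (0 : ℝ) ≤ j := j.cast_nonneg
      have h5 : (j + 1 : ℝ) ≠ 0 := by positivity
      have h6 : (j + 2 : ℝ) ≠ 0 := by positivity
      have h7 : (2 * n + 1 - j : ℝ) ≠ 0 := by linarith
      rw [padeCoeff_succ_succ β (n := n + 1) (j := j + 1) (by omega),
        padeCoeff_succ β (n + 1) (j + 1), padeCoeff_succ_succ β hj]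
      push_cast
      rw [show (2 * (n + 1 : ℝ) - (j + 1)) = 2 * n + 1 - j by ring,
        show (2 * (n + 1 : ℝ) + 1) = 2 * n + 3 by ring,
        show (2 * (n + 1 : ℝ) + 2) = 2 * (n + 2) by ring,
        show (2 * (n : ℝ) + 2) = 2 * (n + 1) by ring,
        show (j + 1 + 1 : ℝ) = j + 2 by ring,
        show (2 * n + 3 - (j + 1) : ℝ) = 2 * n + 1 - j + 1 by ring]
      obtain ⟨d, hd⟩ : ∃ d : ℝ, 2 * n + 1 - j = d := ⟨_, rfl⟩
      rw [hd] at h7 ⊢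
      field_simp
      rw [← hd]
      ring
    · rw [padeCoeff_eq_zero β (by omega : n + 2 < j + 2),
        padeCoeff_eq_zero β (by omega : n + 1 < j + 2),
        padeCoeff_eq_zero β (by omega : n + 1 < j + 1), padeCoeff_eq_zero β hj]
      simp

/-! ### Values of the Padé polynomials on the half-line -/

lemma eval_padePoly (β : ℝ) (m : ℕ) (t : ℝ) :
    (padePoly β m).eval t = ∑ k ∈ Finset.range (m + 1), padeCoeff β m k * t ^ k := by
  simp [padePoly, eval_finsetSum]

lemma eval_padePoly_pos {β : ℝ} (hβ : -1 < β) (m : ℕ) {t : ℝ} (ht : 0 ≤ t) :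
    0 < (padePoly β m).eval t := by
  rw [eval_padePoly]
  refine Finset.sum_pos' (fun k _ => mul_nonneg (padeCoeff_nonneg hβ m k) (pow_nonneg ht k))
    ⟨0, by simp, by simp [padeCoeff_zero]⟩

lemma eval_padePoly_le {β γ : ℝ} (hβ : -1 < β) (h : β ≤ γ) (m : ℕ) {t : ℝ} (ht : 0 ≤ t) :
    (padePoly β m).eval t ≤ (padePoly γ m).eval t := by
  rw [eval_padePoly, eval_padePoly]
  exact Finset.sum_le_sum fun k _ =>
    mul_le_mul_of_nonneg_right (padeCoeff_le hβ h m k) (pow_nonneg ht k)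

lemma eval_padePoly_zero (β t : ℝ) : (padePoly β 0).eval t = 1 := by
  simp [eval_padePoly, padeCoeff_zero]

lemma eval_padePoly_one (β t : ℝ) : (padePoly β 1).eval t = 1 + (1 + β) / 2 * t := by
  simp [eval_padePoly, Finset.sum_range_succ, padeCoeff_zero, padeCoeff_succ]

/-- The larger root of the limit `z ^ 2 - (1 + t / 2) z + t ^ 2 / 16` of the characteristic
polynomials of the three-term recurrence; it is the growth rate of the Padé polynomials. -/
noncomputable def growth (t : ℝ) : ℝ := ((√(1 + t) + 1) / 2) ^ 2

/-- The smaller root of the limit `z ^ 2 - (1 + t / 2) z + t ^ 2 / 16` of the characteristic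
polynomials of the three-term recurrence. -/
noncomputable def cogrowth (t : ℝ) : ℝ := ((√(1 + t) - 1) / 2) ^ 2

lemma growth_pos {t : ℝ} : 0 < growth t := by
  have := Real.sqrt_nonneg (1 + t)
  unfold growth; positivity

lemma cogrowth_nonneg (t : ℝ) : 0 ≤ cogrowth t := sq_nonneg _

lemma growth_add_cogrowth {t : ℝ} (ht : 0 ≤ t) : growth t + cogrowth t = 1 + t / 2 := by
  have := Real.sq_sqrt (by linarith : 0 ≤ 1 + t)
  unfold growth cogrowth
  linear_combination this / 2

lemma growth_mul_cogrowth {t : ℝ} (ht : 0 ≤ t) : growth t * cogrowth t = t ^ 2 / 16 := by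
  have := Real.sq_sqrt (by linarith : 0 ≤ 1 + t)
  unfold growth cogrowth
  linear_combination (√(1 + t) ^ 2 - 1 + t) / 16 * this

/-- At `t = 1` the ratio of the two roots is `17 - 12 √2 ≤ 1 / 32`; this is the source of the rate
`2 ^ (-5m)`. -/
lemma cogrowth_le {t : ℝ} (ht0 : 0 ≤ t) (ht : t ≤ 1) : 32 * cogrowth t ≤ growth t := by
  have h1 : 1 ≤ √(1 + t) := Real.one_le_sqrt.2 (by linarith)
  have h2 : √(1 + t) ≤ 1.4143 := by
    rw [Real.sqrt_le_left (by norm_num)]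
    linarith
  have h3 := Real.sq_sqrt (by linarith : 0 ≤ 1 + t)
  have h4 : √(1 + t) ^ 2 ≤ 2 := by linarith
  unfold growth cogrowth
  nlinarith

lemma eval_padePoly_add_two (β : ℝ) (n : ℕ) {t : ℝ} (ht : 0 ≤ t) :
    (padePoly β (n + 2)).eval t =
      (growth t + cogrowth t) * (padePoly β (n + 1)).eval t -
        growth t * cogrowth t * (((n + 1) ^ 2 - β ^ 2) / ((n + 1) ^ 2 - 1 / 4)) *
          (padePoly β n).eval t := by
  rw [padePoly_three_term, growth_add_cogrowth ht, growth_mul_cogrowth ht]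
  have h1 : (2 * n + 1 : ℝ) ≠ 0 := by positivity
  have h2 : (2 * n + 3 : ℝ) ≠ 0 := by positivity
  have h3 : ((n + 1) ^ 2 - 1 / 4 : ℝ) = (2 * n + 1) * (2 * n + 3) / 4 := by ring
  simp only [eval_add, eval_sub, eval_mul, eval_C, eval_X, eval_pow]
  rw [h3]
  field_simp
  ring

/-! ### Lower bounds for the denominator -/

/-- If `β ≥ 1 / 2`, the recurrence coefficients are at most their limit, so that the ratios of
consecutive denominators are at least `growth t`. -/
lemma growth_mul_le_of_half_le {β : ℝ} (hβ : 1 / 2 ≤ β) (n : ℕ) {t : ℝ} (ht : 0 ≤ t) :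
    growth t * (padePoly β n).eval t ≤ (padePoly β (n + 1)).eval t := by
  have hX := growth_pos (t := t)
  have hY := cogrowth_nonneg t
  induction n with
  | zero =>
    have h := growth_add_cogrowth ht
    rw [eval_padePoly_zero, zero_add, eval_padePoly_one]
    nlinarith
  | succ n ih =>
    rw [eval_padePoly_add_two β n ht]
    have hQ := eval_padePoly_pos (by linarith : -1 < β) n ht
    have hn : (0 : ℝ) ≤ n := n.cast_nonneg
    have hd : (0 : ℝ) < (n + 1) ^ 2 - 1 / 4 := by nlinarith
    have hγ : ((n + 1) ^ 2 - β ^ 2 : ℝ) / ((n + 1) ^ 2 - 1 / 4) ≤ 1 := by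
      rw [div_le_one hd]; nlinarith
    have h1 : growth t * cogrowth t * (((n + 1) ^ 2 - β ^ 2) / ((n + 1) ^ 2 - 1 / 4)) *
        (padePoly β n).eval t ≤ growth t * cogrowth t * 1 * (padePoly β n).eval t := by
      gcongr
    have h2 := mul_le_mul_of_nonneg_left ih hY
    nlinarith

lemma growth_pow_le_of_half_le {β : ℝ} (hβ : 1 / 2 ≤ β) (n : ℕ) {t : ℝ} (ht0 : 0 ≤ t)
    (ht : t ≤ 1) (hβ1 : β ≤ 1) :
    growth t ^ (n + 1) * (1 + (β / 2 - 1 / 4) * t) ≤ (padePoly β (n + 1)).eval t := by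
  have hX := growth_pos (t := t)
  induction n with
  | zero =>
    have h := growth_add_cogrowth ht0
    have hY := cogrowth_nonneg t
    have hX1 : growth t ≤ 1 + t / 2 := by linarith
    rw [zero_add, eval_padePoly_one, pow_one]
    have h1 : growth t * (1 + (β / 2 - 1 / 4) * t) ≤ (1 + t / 2) * (1 + (β / 2 - 1 / 4) * t) :=
      mul_le_mul_of_nonneg_right hX1
        (add_nonneg zero_le_one (mul_nonneg (by linarith) ht0))
    have h2 : (β / 2 - 1 / 4) * t * t ≤ 1 / 4 * 1 * t := by gcongr; linarith
    nlinarith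
  | succ n ih =>
    refine le_trans ?_ (growth_mul_le_of_half_le hβ (n + 1) ht0)
    have := mul_le_mul_of_nonneg_left ih hX.le
    rw [pow_succ]
    linarith

/-- If `β ≤ 1 / 2`, the recurrence coefficients exceed their limit by a summable relative amount of
at most `1 / (4 m ^ 2 - 1)`, and the ratios of consecutive denominators can fall below `growth t` by
a comparable amount. -/
lemma growth_sub_mul_le {β : ℝ} (hβ : 0 ≤ β) (n : ℕ) {t : ℝ} (ht0 : 0 ≤ t) (ht : t ≤ 1) :
    (growth t - 3 / 2 * cogrowth t / ((2 * n + 1) * (2 * n + 3))) * (padePoly β (n + 1)).eval t ≤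
      (padePoly β (n + 2)).eval t := by
  have hX := growth_pos (t := t)
  have hY := cogrowth_nonneg t
  have hXY := cogrowth_le ht0 ht
  have hQ : ∀ k, 0 < (padePoly β k).eval t := fun k => eval_padePoly_pos (by linarith) k ht0
  have hγ : ∀ k : ℕ, ((k + 1) ^ 2 - β ^ 2 : ℝ) / ((k + 1) ^ 2 - 1 / 4) ≤
      1 + 1 / ((2 * k + 1) * (2 * k + 3)) := by
    intro k
    have h1 : (0 : ℝ) < (2 * k + 1) * (2 * k + 3) := by positivity
    rw [show ((k + 1) ^ 2 - 1 / 4 : ℝ) = (2 * k + 1) * (2 * k + 3) / 4 by ring,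
      show (1 + 1 / ((2 * k + 1) * (2 * k + 3)) : ℝ) =
        (k + 1) ^ 2 / ((2 * k + 1) * (2 * k + 3) / 4) by field_simp; ring]
    gcongr
    nlinarith
  -- It suffices to control the subtracted term of the recurrence.
  have key : ∀ k : ℕ,
      growth t * (1 + 1 / ((2 * k + 1) * (2 * k + 3))) * (padePoly β k).eval t ≤
        (1 + 3 / 2 * (1 / ((2 * k + 1) * (2 * k + 3)))) * (padePoly β (k + 1)).eval t →
      (growth t - 3 / 2 * cogrowth t / ((2 * k + 1) * (2 * k + 3))) *
        (padePoly β (k + 1)).eval t ≤ (padePoly β (k + 2)).eval t := by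
    intro k hk
    rw [eval_padePoly_add_two β k ht0]
    have h1 : growth t * cogrowth t * (((k + 1) ^ 2 - β ^ 2) / ((k + 1) ^ 2 - 1 / 4)) *
        (padePoly β k).eval t ≤
        growth t * cogrowth t * (1 + 1 / ((2 * k + 1) * (2 * k + 3))) * (padePoly β k).eval t := by
      have := (hQ k).le
      gcongr
      exact hγ k
    have h2 := mul_le_mul_of_nonneg_left hk hY
    have h3 : 3 / 2 * cogrowth t / ((2 * k + 1) * (2 * k + 3)) =
      cogrowth t * (3 / 2 * (1 / ((2 * k + 1) * (2 * k + 3)))) := by ring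
    rw [h3]
    nlinarith
  refine key n ?_
  induction n with
  | zero =>
    have h := growth_add_cogrowth ht0
    rw [eval_padePoly_zero, zero_add, eval_padePoly_one]
    norm_num
    nlinarith
  | succ n ih =>
    have ih' := key n ih
    refine le_trans ?_ (mul_le_mul_of_nonneg_left ih' (by positivity))
    rw [← mul_assoc]
    refine mul_le_mul_of_nonneg_right ?_ (hQ _).le
    push_cast
    set d : ℝ := 1 / ((2 * (n + 1) + 1) * (2 * (n + 1) + 3)) with hd
    have hn : (0 : ℝ) ≤ n := n.cast_nonneg
    have hd0 : 0 < d := by positivity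
    have hd1 : d ≤ 1 / 15 := by
      rw [hd]
      refine one_div_le_one_div_of_le (by norm_num) ?_
      nlinarith
    have hd5 : 1 / ((2 * n + 1) * (2 * n + 3)) ≤ 5 * d := by
      rw [hd, mul_one_div, div_le_div_iff₀ (by positivity) (by positivity)]
      nlinarith
    have h1 : 3 / 2 * cogrowth t / ((2 * n + 1) * (2 * n + 3)) ≤ 3 / 2 * (growth t / 32) * (5 * d) := by
      rw [div_eq_mul_one_div]
      gcongr
      linarith
    calc growth t * (1 + d)
        ≤ (1 + 3 / 2 * d) * (growth t - 3 / 2 * (growth t / 32) * (5 * d)) := by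
          have : 0 ≤ growth t * d * (1 / 15 - d) :=
            mul_nonneg (mul_nonneg hX.le hd0.le) (by linarith)
          nlinarith [mul_pos hX hd0]
      _ ≤ _ := by gcongr

lemma growth_pow_le {β : ℝ} (hβ : 0 ≤ β) (n : ℕ) {t : ℝ} (ht0 : 0 ≤ t) (ht : t ≤ 1) :
    growth t ^ (n + 1) ≤ (padePoly β (n + 1)).eval t := by
  have hX := growth_pos (t := t)
  have hXY := cogrowth_le ht0 ht
  obtain ⟨y, hy⟩ : ∃ y, cogrowth t = growth t * y := ⟨cogrowth t / growth t, by field_simp⟩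
  have hy0 : 0 ≤ y := by
    have := cogrowth_nonneg t
    rw [hy] at this
    exact nonneg_of_mul_nonneg_right this hX
  have hy1 : y ≤ 1 / 32 := by
    rw [hy] at hXY
    nlinarith
  -- The losses of `growth_sub_mul_le` telescope.
  have h : growth t ^ (n + 1) * ((1 + y) * (1 - 3 / 4 * y * (1 - 1 / (2 * n + 1)))) ≤
      (padePoly β (n + 1)).eval t := by
    induction n with
    | zero =>
      have h := growth_add_cogrowth ht0
      rw [zero_add, eval_padePoly_one]
      norm_num
      nlinarith
    | succ n ih =>
      have hn : (0 : ℝ) ≤ n := n.cast_nonneg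
      set d : ℝ := 1 / ((2 * n + 1) * (2 * n + 3)) with hd
      have hd0 : 0 < d := by positivity
      have hd1 : d ≤ 1 := by
        rw [hd, div_le_one (by positivity)]
        nlinarith
      have h1 := growth_sub_mul_le hβ n ht0 ht
      have h2 : growth t - 3 / 2 * cogrowth t / ((2 * n + 1) * (2 * n + 3)) =
          growth t * (1 - 3 / 2 * y * d) := by rw [hy, hd]; ring
      rw [h2] at h1
      have h3 : 0 ≤ 1 - 3 / 2 * y * d := by nlinarith
      refine le_trans ?_ h1
      refine le_trans ?_ (mul_le_mul_of_nonneg_left ih (mul_nonneg hX.le h3))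
      have h4 : (1 : ℝ) / (2 * n + 1) = 1 / (2 * ((n + 1 : ℕ) : ℝ) + 1) + 2 * d := by
        rw [hd]; push_cast; field_simp; ring
      have h5 : (0 : ℝ) ≤ 1 - 1 / (2 * n + 1) := by
        rw [sub_nonneg, div_le_one (by positivity)]; linarith
      rw [h4] at h5 ⊢
      set e : ℝ := 1 / (2 * ((n + 1 : ℕ) : ℝ) + 1)
      have h6 : 1 - 3 / 4 * y * (1 - e) ≤
          (1 - 3 / 2 * y * d) * (1 - 3 / 4 * y * (1 - (e + 2 * d))) := by
        have : 0 ≤ (y * d) * (y * (1 - (e + 2 * d))) := by positivity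
        nlinarith
      calc growth t ^ (n + 1 + 1) * ((1 + y) * (1 - 3 / 4 * y * (1 - e)))
          ≤ growth t ^ (n + 1 + 1) * ((1 + y) *
            ((1 - 3 / 2 * y * d) * (1 - 3 / 4 * y * (1 - (e + 2 * d))))) := by gcongr
        _ = _ := by rw [pow_succ]; ring
  refine le_trans ?_ h
  refine le_mul_of_one_le_right (by positivity) ?_
  have h5 : (0 : ℝ) ≤ 1 / (2 * n + 1) := by positivity
  have h6 : 0 ≤ y * (1 / (2 * n + 1)) := by positivity
  nlinarith

/-- A lower bound for the denominator of the Padé approximant which has the exact growth in `m`. -/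
lemma growth_pow_mul_rpow_le {β : ℝ} (hβ0 : 0 ≤ β) (hβ1 : β ≤ 1) {m : ℕ} (hm : 1 ≤ m) {t : ℝ}
    (ht0 : 0 ≤ t) (ht : t ≤ 1) :
    growth t ^ (2 * m) * (1 + t) ^ (β - 1 / 2) ≤ (padePoly β m).eval t ^ 2 := by
  obtain ⟨n, rfl⟩ : ∃ n, m = n + 1 := ⟨m - 1, by omega⟩
  have hX := growth_pos (t := t)
  rw [mul_comm 2, pow_mul]
  rcases le_total (1 / 2) β with h | h
  · have h1 : (1 + t) ^ (β - 1 / 2) ≤ (1 + (β / 2 - 1 / 4) * t) ^ 2 := by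
      have := rpow_one_add_le_one_add_mul_self (by linarith : -1 ≤ t)
        (by linarith : 0 ≤ β - 1 / 2) (by linarith)
      nlinarith [sq_nonneg ((β / 2 - 1 / 4) * t)]
    have h2 : 0 ≤ (β / 2 - 1 / 4) * t := mul_nonneg (by linarith) ht0
    calc _ ≤ (growth t ^ (n + 1)) ^ 2 * (1 + (β / 2 - 1 / 4) * t) ^ 2 := by gcongr
      _ = (growth t ^ (n + 1) * (1 + (β / 2 - 1 / 4) * t)) ^ 2 := by ring
      _ ≤ _ := by
        gcongr
        exact growth_pow_le_of_half_le h n ht0 ht hβ1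
  · have h1 : (1 + t) ^ (β - 1 / 2) ≤ 1 :=
      Real.rpow_le_one_of_one_le_of_nonpos (by linarith) (by linarith)
    calc _ ≤ (growth t ^ (n + 1)) ^ 2 * 1 := by gcongr
      _ ≤ _ := by
        rw [mul_one]
        gcongr
        exact growth_pow_le hβ0 n ht0 ht

/-! ### The constant of the error bound -/

/-- The normalized constant `16 ^ m κ_m / (2m + 1)`, where `κ_m` is the leading coefficient of the
residual. -/
noncomputable def errorConst (α : ℝ) (m : ℕ) : ℝ := 16 ^ m * padeKappa α m / (2 * m + 1)

lemma errorConst_succ (α : ℝ) (m : ℕ) :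
    errorConst α (m + 1) =
      errorConst α m * (((m + 1) ^ 2 - α ^ 2) / ((m + 1) ^ 2 - 1 / 4)) := by
  have h1 : (2 * m + 1 : ℝ) ≠ 0 := by positivity
  have h2 : (2 * m + 2 : ℝ) ≠ 0 := by positivity
  have h3 : (2 * m + 3 : ℝ) ≠ 0 := by positivity
  have h4 : (m + 1 : ℝ) ≠ 0 := by positivity
  rw [errorConst, errorConst, padeKappa, padeKappa, padeCoeff_succ_succ _ le_rfl,
    padeCoeff_succ_succ _ le_rfl,
    show ((m + 1) ^ 2 - 1 / 4 : ℝ) = (2 * m + 1) * (2 * m + 3) / 4 by ring]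
  push_cast
  rw [show (2 * (m + 1) + 1 : ℝ) = 2 * m + 3 by ring, show (2 * m + 1 - m : ℝ) = m + 1 by ring,
    show (2 * m + 2 : ℝ) = 2 * (m + 1) by ring]
  field_simp
  ring

lemma errorConst_pos {α : ℝ} (hα0 : 0 < α) (hα1 : α < 1) (m : ℕ) : 0 < errorConst α m := by
  have := padeKappa_pos hα0 hα1 m
  unfold errorConst
  positivity

/-- The limit comes from Euler's product for the sine, at `α` and at `1 / 2`. -/
lemma tendsto_errorConst (α : ℝ) :
    Filter.Tendsto (errorConst α) Filter.atTop (nhds (Real.sin (Real.pi * α) / 2)) := by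
  have h1 := Real.tendsto_euler_sin_prod α
  have h2 := Real.tendsto_euler_sin_prod (1 / 2)
  rw [mul_one_div, Real.sin_pi_div_two] at h2
  have h3 := (h1.div h2 one_ne_zero).div_const 2
  rw [div_one] at h3
  refine h3.congr fun n => ?_
  simp only [Pi.div_apply]
  have hπ := Real.pi_ne_zero
  have hpos : ∀ n : ℕ, ∏ j ∈ Finset.range n, (1 - (1 / 2 : ℝ) ^ 2 / ((j : ℝ) + 1) ^ 2) ≠ 0 := by
    intro n
    refine Finset.prod_ne_zero_iff.2 fun j _ => ?_
    have hj : (0 : ℝ) ≤ j := j.cast_nonneg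
    have : (1 / 2 : ℝ) ^ 2 / ((j : ℝ) + 1) ^ 2 < 1 := by
      rw [div_lt_one (by positivity)]; nlinarith
    linarith
  induction n with
  | zero => simp [errorConst, padeKappa, padeCoeff_zero]; field_simp
  | succ n ih =>
    rw [errorConst_succ, ← ih]
    have h1 := hpos n
    have h2 := hpos (n + 1)
    rw [Finset.prod_range_succ] at h2
    have h3 := right_ne_zero_of_mul h2
    rw [Finset.prod_range_succ, Finset.prod_range_succ]
    have hn : (n + 1 : ℝ) ≠ 0 := by positivity
    have e1 : (1 - α ^ 2 / ((n : ℝ) + 1) ^ 2) = ((n + 1) ^ 2 - α ^ 2) / (n + 1) ^ 2 := by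
      field_simp
    have e2 : (1 - (1 / 2) ^ 2 / ((n : ℝ) + 1) ^ 2) = ((n + 1) ^ 2 - 1 / 4) / (n + 1) ^ 2 := by
      field_simp; ring
    rw [e2] at h3
    have h4 : ((n + 1) ^ 2 - 1 / 4 : ℝ) ≠ 0 := (div_ne_zero_iff.1 h3).1
    rw [e1, e2]
    obtain ⟨d, hd⟩ : ∃ d : ℝ, ((n : ℝ) + 1) ^ 2 - 1 / 4 = d := ⟨_, rfl⟩
    rw [hd] at h4 ⊢
    field_simp

/-- By Bernoulli's inequality `(1 - 1 / i ^ 2) ^ (α ^ 2) ≤ 1 - α ^ 2 / i ^ 2`, the relative decrease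
of `errorConst` from index `m` to `m + k` is bounded by a telescoping product. -/
lemma errorConst_mul_rpow_le {α : ℝ} (hα0 : 0 < α) (hα1 : α < 1) {m : ℕ} (hm : 1 ≤ m) (k : ℕ) :
    errorConst α m * ((m * (m + k + 1)) / ((m + 1) * (m + k)) : ℝ) ^ (α ^ 2) ≤
      errorConst α (m + k) := by
  have hm1 : (1 : ℝ) ≤ m := by exact_mod_cast hm
  induction k with
  | zero =>
    have h : (m * (m + (0 : ℕ) + 1) / ((m + 1) * (m + (0 : ℕ))) : ℝ) = 1 := by
      push_cast; rw [add_zero]; field_simp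
    rw [h, Real.one_rpow, mul_one, add_zero]
  | succ k ih =>
    rw [← add_assoc, errorConst_succ]
    have hk : (0 : ℝ) ≤ k := k.cast_nonneg
    push_cast
    set i : ℝ := m + k + 1 with hi
    have hi2 : 2 ≤ i := by linarith
    have hfac : (1 - 1 / i ^ 2) ^ (α ^ 2) ≤ (i ^ 2 - α ^ 2) / (i ^ 2 - 1 / 4) := by
      have h1 : (1 : ℝ) / i ^ 2 ≤ 1 := by rw [div_le_one (by positivity)]; nlinarith
      have hb := rpow_one_add_le_one_add_mul_self (s := -(1 / i ^ 2)) (p := α ^ 2) (by linarith)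
        (by positivity) (by nlinarith)
      have h2 : (1 + α ^ 2 * -(1 / i ^ 2) : ℝ) = (i ^ 2 - α ^ 2) / i ^ 2 := by
        field_simp; ring
      rw [h2] at hb
      refine (by simpa [sub_eq_add_neg] using hb : _ ≤ (i ^ 2 - α ^ 2) / i ^ 2).trans ?_
      refine div_le_div_of_nonneg_left (by nlinarith) (by nlinarith) (by linarith)
    have hsplit : (m * (m + (k + 1) + 1) / ((m + 1) * (m + (k + 1))) : ℝ) =
        (m * (m + k + 1) / ((m + 1) * (m + k))) * (1 - 1 / i ^ 2) := by
      have hmk : (m + k : ℝ) ≠ 0 := by positivity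
      have hi0 : (m + k + 1 : ℝ) ≠ 0 := by positivity
      rw [hi, ← add_assoc]
      field_simp
      ring
    have h1i : (0 : ℝ) ≤ 1 - 1 / i ^ 2 := by
      rw [sub_nonneg, div_le_one (by positivity)]; nlinarith
    rw [hsplit, Real.mul_rpow (by positivity) h1i, ← mul_assoc]
    exact mul_le_mul ih hfac (Real.rpow_nonneg h1i _) (errorConst_pos hα0 hα1 _).le

lemma cPrime_eq {α : ℝ} (hα0 : 0 < α) : cPrime α = Real.sin (Real.pi * α) / 2 := by
  have h := Real.Gamma_mul_Gamma_one_sub α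
  have h1 : Real.Gamma (1 + α) = α * Real.Gamma α := by
    rw [add_comm, Real.Gamma_add_one hα0.ne']
  have h2 : 2 * Real.Gamma (1 - α) * Real.Gamma (1 + α) =
      2 * α * (Real.pi / Real.sin (Real.pi * α)) := by
    rw [h1, ← h]; ring
  have hπ := Real.pi_ne_zero
  rw [cPrime, h2]
  rcases eq_or_ne (Real.sin (Real.pi * α)) 0 with h0 | h0
  · simp [h0]
  · field_simp

lemma errorConst_le {α : ℝ} (hα0 : 0 < α) (hα1 : α < 1) {m : ℕ} (hm : 1 ≤ m) :
    errorConst α m ≤ 2 ^ α * cPrime α := by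
  have hm1 : (1 : ℝ) ≤ m := by exact_mod_cast hm
  have hs := errorConst_pos hα0 hα1 m
  have h : ∀ k : ℕ, errorConst α m * (1 / 2 : ℝ) ^ α ≤ errorConst α (k + m) := by
    intro k
    rw [add_comm k]
    refine le_trans ?_ (errorConst_mul_rpow_le hα0 hα1 hm k)
    refine mul_le_mul_of_nonneg_left ?_ hs.le
    have hk : (0 : ℝ) ≤ k := k.cast_nonneg
    calc (1 / 2 : ℝ) ^ α ≤ (1 / 2 : ℝ) ^ (α ^ 2) :=
          Real.rpow_le_rpow_of_exponent_ge (by norm_num) (by norm_num) (by nlinarith)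
      _ ≤ _ := by
          refine Real.rpow_le_rpow (by norm_num) ?_ (by positivity)
          rw [div_le_div_iff₀ (by norm_num) (by positivity)]
          nlinarith
  have hlim := ge_of_tendsto'
    ((tendsto_errorConst α).comp (Filter.tendsto_add_atTop_nat m)) h
  rw [cPrime_eq hα0]
  calc errorConst α m = 2 ^ α * (errorConst α m * (1 / 2 : ℝ) ^ α) := by
        rw [mul_left_comm, ← Real.mul_rpow (by norm_num) (by norm_num)]; norm_num
    _ ≤ _ := by gcongr

/-! ### The error of the Padé approximant on the unit interval -/

lemma hasDerivAt_pade (α : ℝ) (hα0 : 0 < α) (hα1 : α < 1) {m : ℕ} (hm : 1 ≤ m) {t : ℝ}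
    (ht : 0 ≤ t) :
    HasDerivAt (fun x => (1 + x) ^ α * ((padePoly (-α) m).eval x / (padePoly α m).eval x))
      (padeKappa α m * t ^ (2 * m) * (1 + t) ^ (α - 1) / (padePoly α m).eval t ^ 2) t := by
  have hQ := (eval_padePoly_pos (by linarith : -1 < α) m ht).ne'
  have h1 : HasDerivAt (fun x : ℝ => (1 + x) ^ α) (α * (1 + t) ^ (α - 1)) t := by
    have := ((hasDerivAt_id t).const_add 1).rpow_const (p := α) (Or.inl (by simp; linarith))
    simpa [mul_comm] using this
  have h2 := h1.mul (((padePoly (-α) m).hasDerivAt t).div ((padePoly α m).hasDerivAt t) hQ)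
  have hres := congrArg (fun p => p.eval t) (residual_padePoly α hm)
  simp only [residual, eval_add, eval_mul, eval_sub, eval_one, eval_X, eval_C, eval_pow] at hres
  refine h2.congr_deriv ?_
  have h3 : (1 + t) ^ α = (1 + t) ^ (α - 1) * (1 + t) := by
    rw [← Real.rpow_add_one (by linarith), sub_add_cancel]
  rw [h3, ← hres]
  simp only [Pi.div_apply]
  field_simp
  ring

/-- The ratio `(√(1 + t) - 1) / (√(1 + t) + 1)`, the convergence rate of the Padé approximants at `t`
being its square. -/
noncomputable def rate (t : ℝ) : ℝ := (√(1 + t) - 1) / (√(1 + t) + 1)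

lemma rate_nonneg {t : ℝ} (ht : 0 ≤ t) : 0 ≤ rate t := by
  have h1 : 1 ≤ √(1 + t) := Real.one_le_sqrt.2 (by linarith)
  exact div_nonneg (by linarith) (by linarith)

lemma rate_sq_le {t : ℝ} (ht0 : 0 ≤ t) (ht : t ≤ 1) : rate t ^ 2 ≤ 1 / 32 := by
  have h := cogrowth_le ht0 ht
  have h1 : 1 ≤ √(1 + t) := Real.one_le_sqrt.2 (by linarith)
  rw [rate, div_pow, div_le_div_iff₀ (by positivity) (by norm_num)]
  unfold cogrowth growth at h
  linarith

lemma rate_eq {t : ℝ} (ht : 0 ≤ t) : 4 * rate t * growth t = t := by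
  have h1 := Real.sqrt_nonneg (1 + t)
  have h3 := Real.sq_sqrt (by linarith : 0 ≤ 1 + t)
  unfold rate growth
  field_simp
  linear_combination 4 * h3

lemma hasDerivAt_mul_rate_pow {t : ℝ} (ht : 0 ≤ t) (n : ℕ) :
    HasDerivAt (fun x => x * rate x ^ n) (rate t ^ n * (1 + n / √(1 + t))) t := by
  have h0 : (0 : ℝ) < 1 + t := by linarith
  have h1 : 0 < √(1 + t) := Real.sqrt_pos.2 h0
  have h3 := Real.sq_sqrt h0.le
  have hs : HasDerivAt (fun x : ℝ => √(1 + x)) (1 / (2 * √(1 + t))) t := by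
    have := ((hasDerivAt_id t).const_add 1).sqrt h0.ne'
    simpa using this
  have hr : HasDerivAt rate (1 / (√(1 + t) * (√(1 + t) + 1) ^ 2)) t := by
    refine ((hs.sub_const 1).div (hs.add_const 1) (by positivity)).congr_deriv ?_
    field_simp
    ring
  have hm := (hasDerivAt_id t).mul (hr.pow n)
  refine hm.congr_deriv ?_
  simp only [id, Pi.pow_apply]
  rcases n with - | n
  · simp
  · have h4 : t * (1 / (√(1 + t) * (√(1 + t) + 1) ^ 2)) = rate t / √(1 + t) := by
      unfold rate
      field_simp
      linear_combination -h3
    rw [Nat.add_sub_cancel, mul_left_comm, h4]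
    push_cast
    ring

/-- The error bound of the diagonal Padé approximant `r = P / Q` of `(1 + t) ^ (-α)`: by
`hasDerivAt_pade` and the lower bound for the denominator, the derivative of `(1 + t) ^ α r(t)` is at
most that of `errorConst α m * t * rate t ^ (2m)`. -/
lemma pade_error {α : ℝ} (hα0 : 0 < α) (hα1 : α < 1) {m : ℕ} (hm : 1 ≤ m) {t : ℝ}
    (ht0 : 0 ≤ t) (ht : t ≤ 1) :
    |(1 + t) ^ (-α) - (padePoly (-α) m).eval t / (padePoly α m).eval t| ≤
      2 ^ α * cPrime α * (1 / 32) ^ m * t := by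
  set w : ℝ → ℝ :=
    fun x => (1 + x) ^ α * ((padePoly (-α) m).eval x / (padePoly α m).eval x) with hw
  set G : ℝ → ℝ := fun x => errorConst α m * (x * rate x ^ (2 * m)) with hG
  have hκ := padeKappa_pos hα0 hα1 m
  have hwd : ∀ x ∈ Set.Icc (0 : ℝ) 1, HasDerivAt w
      (padeKappa α m * x ^ (2 * m) * (1 + x) ^ (α - 1) / (padePoly α m).eval x ^ 2) x :=
    fun x hx => hasDerivAt_pade α hα0 hα1 hm hx.1
  have hGd : ∀ x ∈ Set.Icc (0 : ℝ) 1, HasDerivAt G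
      (errorConst α m * (rate x ^ (2 * m) * (1 + (2 * m : ℕ) / √(1 + x)))) x :=
    fun x hx => (hasDerivAt_mul_rate_pow hx.1 (2 * m)).const_mul _
  have hle : ∀ x ∈ Set.Icc (0 : ℝ) 1,
      padeKappa α m * x ^ (2 * m) * (1 + x) ^ (α - 1) / (padePoly α m).eval x ^ 2 ≤
        errorConst α m * (rate x ^ (2 * m) * (1 + (2 * m : ℕ) / √(1 + x))) := by
    intro x hx
    have hX := growth_pos (t := x)
    have hr := rate_nonneg hx.1
    have h1x : 0 < 1 + x := by linarith [hx.1]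
    have hs1 : 1 ≤ √(1 + x) := Real.one_le_sqrt.2 (by linarith [hx.1])
    have hlow := growth_pow_mul_rpow_le hα0.le hα1.le hm hx.1 hx.2
    have hpow := Real.rpow_pos_of_pos h1x (α - 1 / 2)
    have hsplit : (1 + x) ^ (α - 1) = (1 + x) ^ (α - 1 / 2) / √(1 + x) := by
      rw [Real.sqrt_eq_rpow, ← Real.rpow_sub h1x]; congr 1; ring
    have hx' : x ^ (2 * m) = 16 ^ m * rate x ^ (2 * m) * growth x ^ (2 * m) := by
      conv_lhs => rw [← rate_eq hx.1]
      rw [mul_pow, mul_pow, pow_mul 4]; norm_num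
    calc padeKappa α m * x ^ (2 * m) * (1 + x) ^ (α - 1) / (padePoly α m).eval x ^ 2
        ≤ padeKappa α m * x ^ (2 * m) * (1 + x) ^ (α - 1) /
            (growth x ^ (2 * m) * (1 + x) ^ (α - 1 / 2)) := by
          refine div_le_div_of_nonneg_left ?_ (by positivity) hlow
          have := hx.1
          positivity
      _ = 16 ^ m * padeKappa α m * rate x ^ (2 * m) / √(1 + x) := by
          rw [hsplit, hx']; field_simp
      _ = errorConst α m * (rate x ^ (2 * m) * (1 / √(1 + x) + (2 * m : ℕ) / √(1 + x))) := by
          unfold errorConst; push_cast; field_simp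
          ring
      _ ≤ _ := by
          have := (errorConst_pos hα0 hα1 m).le
          gcongr
          rw [div_le_one (by linarith)]
          exact hs1
  have hint : interior (Set.Icc (0 : ℝ) 1) ⊆ Set.Icc 0 1 := interior_subset
  have hmono1 : MonotoneOn w (Set.Icc 0 1) := by
    refine monotoneOn_of_hasDerivWithinAt_nonneg (convex_Icc 0 1)
      (fun x hx => (hwd x hx).continuousAt.continuousWithinAt)
      (fun x hx => (hwd x (hint hx)).hasDerivWithinAt) (fun x hx => ?_)
    have := (hint hx).1
    positivity
  have hmono2 : MonotoneOn (fun x => G x - w x) (Set.Icc 0 1) := by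
    refine monotoneOn_of_hasDerivWithinAt_nonneg (convex_Icc 0 1)
      (fun x hx => ((hGd x hx).sub (hwd x hx)).continuousAt.continuousWithinAt)
      (fun x hx => ((hGd x (hint hx)).sub (hwd x (hint hx))).hasDerivWithinAt)
      (fun x hx => sub_nonneg.2 (hle x (hint hx)))
  have hw0 : w 0 = 1 := by
    simp [hw, ← coeff_zero_eq_eval_zero, coeff_padePoly, padeCoeff_zero]
  have hG0 : G 0 = 0 := by simp [hG]
  have h0 : (0 : ℝ) ∈ Set.Icc (0 : ℝ) 1 := by simp
  have hlow := hmono1 h0 ⟨ht0, ht⟩ ht0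
  have hup := hmono2 h0 ⟨ht0, ht⟩ ht0
  simp only [hw0, hG0] at hlow hup
  have h1t : 0 < 1 + t := by linarith
  have hf0 : 0 < (1 + t) ^ (-α) := Real.rpow_pos_of_pos h1t _
  have hf1 : (1 + t) ^ (-α) ≤ 1 :=
    Real.rpow_le_one_of_one_le_of_nonpos (by linarith) (by linarith)
  have hfw : (padePoly (-α) m).eval t / (padePoly α m).eval t = (1 + t) ^ (-α) * w t := by
    simp only [hw]
    rw [← mul_assoc, ← Real.rpow_add h1t, neg_add_cancel, Real.rpow_zero, one_mul]
  have hGt : G t ≤ 2 ^ α * cPrime α * (1 / 32) ^ m * t := by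
    have h1 : rate t ^ (2 * m) ≤ (1 / 32) ^ m := by
      rw [pow_mul]
      exact pow_le_pow_left₀ (sq_nonneg _) (rate_sq_le ht0 ht) m
    calc G t = errorConst α m * (t * rate t ^ (2 * m)) := rfl
      _ ≤ (2 ^ α * cPrime α) * (t * (1 / 32) ^ m) := by
        have h2 := errorConst_le hα0 hα1 hm
        have h3 := errorConst_pos hα0 hα1 m
        have h4 := rate_nonneg ht0
        exact mul_le_mul h2 (by gcongr) (by positivity) (h3.le.trans h2)
      _ = _ := by ring
  rw [hfw, abs_sub_comm, show (1 + t) ^ (-α) * w t - (1 + t) ^ (-α) =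
    (1 + t) ^ (-α) * (w t - 1) by ring, abs_of_nonneg (mul_nonneg hf0.le (by linarith))]
  nlinarith

/-! ### The scalar recurrence -/

/-- Convexity of `x ^ (-α)`: the tangent at `b` lies below the value at `a`. -/
lemma sub_div_mul_rpow_le {α a b : ℝ} (hα : 0 < α) (ha : 0 < a) (hb : 0 < b) :
    (b - a) / b * b ^ (-α) ≤ (a ^ (-α) - b ^ (-α)) / α := by
  have hab : 0 < a / b := div_pos ha hb
  have h1 : 1 + α * (1 - a / b) ≤ (a / b) ^ (-α) := by
    rw [Real.rpow_def_of_pos hab]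
    have h2 := Real.add_one_le_exp (Real.log (a / b) * -α)
    have h3 := Real.log_le_sub_one_of_pos hab
    nlinarith
  have h2 : a ^ (-α) = (a / b) ^ (-α) * b ^ (-α) := by
    rw [← Real.mul_rpow hab.le hb.le, div_mul_cancel₀ _ hb.ne']
  have h3 := Real.rpow_pos_of_pos hb (-α)
  rw [le_div_iff₀ hα, h2, sub_div, div_self hb.ne']
  nlinarith

section Scalar

variable {lhat l : ℝ} {t : ℕ → ℝ} {L : ℕ}

lemma time_nonneg (h0 : t 0 = 0) (ht : ∀ n ≤ L, t n < t (n + 1)) {n : ℕ} (hn : n ≤ L + 1) :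
    0 ≤ t n := by
  induction n with
  | zero => exact h0.ge
  | succ n ih => exact (ih (by omega)).trans (ht n (by omega)).le

lemma shift_pos (h0 : t 0 = 0) (ht : ∀ n ≤ L, t n < t (n + 1)) (hl0 : 0 < lhat) (hl : lhat ≤ l)
    {n : ℕ} (hn : n ≤ L + 1) : 0 < lhat + t n * (l - lhat) :=
  add_pos_of_pos_of_nonneg hl0 (mul_nonneg (time_nonneg h0 ht hn) (sub_nonneg.2 hl))

lemma theta_nonneg (h0 : t 0 = 0) (ht : ∀ n ≤ L, t n < t (n + 1)) (hl0 : 0 < lhat)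
    (hl : lhat ≤ l) {n : ℕ} (hn : n ≤ L) : 0 ≤ theta lhat t n l :=
  div_nonneg (mul_nonneg (sub_nonneg.2 (ht n hn).le) (sub_nonneg.2 hl))
    (shift_pos h0 ht hl0 hl (by omega)).le

lemma theta_mono (h0 : t 0 = 0) (ht : ∀ n ≤ L, t n < t (n + 1)) (hl0 : 0 < lhat)
    (hl : lhat ≤ l) {l' : ℝ} (hl' : l ≤ l') {n : ℕ} (hn : n ≤ L) :
    theta lhat t n l ≤ theta lhat t n l' := by
  rw [theta, theta, div_le_div_iff₀ (shift_pos h0 ht hl0 hl (by omega))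
    (shift_pos h0 ht hl0 (hl.trans hl') (by omega))]
  have h1 : 0 ≤ step t n := sub_nonneg.2 (ht n hn).le
  have h2 : 0 ≤ step t n * (lhat * (l' - l)) :=
    mul_nonneg h1 (mul_nonneg hl0.le (sub_nonneg.2 hl'))
  nlinarith

lemma one_add_theta (h0 : t 0 = 0) (ht : ∀ n ≤ L, t n < t (n + 1)) (hl0 : 0 < lhat)
    (hl : lhat ≤ l) {n : ℕ} (hn : n ≤ L) :
    1 + theta lhat t n l = (lhat + t (n + 1) * (l - lhat)) / (lhat + t n * (l - lhat)) := by
  have h := (shift_pos h0 ht hl0 hl (by omega : n ≤ L + 1)).ne'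
  rw [theta, step]
  field_simp
  ring

/-- The local errors, each at most `C θ_n` relative to the exact value, add up: since
`r_m ≤ 1` they are not amplified, and by `sub_div_mul_rpow_le` and the bound `ν` for the ratio of
consecutive steps their sum telescopes. -/
lemma abs_rpow_sub_mu_le {α : ℝ} (hα0 : 0 < α) (hα1 : α < 1) {m : ℕ} (hm : 1 ≤ m)
    (h0 : t 0 = 0) (ht : ∀ n ≤ L, t n < t (n + 1)) (hl0 : 0 < lhat) (hl : lhat ≤ l)
    (hθ : ∀ n ≤ L, theta lhat t n l ≤ 1) {ν : ℝ} (hν : 0 ≤ ν)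
    (hstep : ∀ n < L, step t (n + 1) / step t n ≤ ν) {n : ℕ} (hn : n ≤ L) :
    |(lhat + t (n + 1) * (l - lhat)) ^ (-α) -
        mu (padePoly (-α) m) (padePoly α m) α lhat t l (n + 1)| ≤
      2 ^ α * cPrime α * (1 / 32) ^ m *
        (lhat ^ (-α) + ν / α * (lhat ^ (-α) - (lhat + t n * (l - lhat)) ^ (-α))) := by
  set C : ℝ := 2 ^ α * cPrime α * (1 / 32) ^ m with hC
  have hC0 : 0 ≤ C := by
    have := (errorConst_pos hα0 hα1 m).le.trans (errorConst_le hα0 hα1 hm)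
    positivity
  set H : ℕ → ℝ := fun n => (lhat + t n * (l - lhat)) ^ (-α) with hH
  set M : ℕ → ℝ := mu (padePoly (-α) m) (padePoly α m) α lhat t l with hM
  have hg : ∀ n ≤ L + 1, 0 < lhat + t n * (l - lhat) := fun n hn => shift_pos h0 ht hl0 hl hn
  have hH0 : H 0 = lhat ^ (-α) := by simp [hH, h0]
  have hM0 : M 0 = lhat ^ (-α) := rfl
  -- One step of the recurrence.
  have hone : ∀ n ≤ L, |H (n + 1) - M (n + 1)| ≤
      C * (theta lhat t n l * H n) + |H n - M n| := by
    intro n hn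
    have hθ0 := theta_nonneg h0 ht hl0 hl hn
    have hHpos : 0 < H n := Real.rpow_pos_of_pos (hg n (by omega)) _
    have hP := eval_padePoly_pos (by linarith : -1 < -α) m hθ0
    have hQ := eval_padePoly_pos (by linarith : -1 < α) m hθ0
    have hPQ := eval_padePoly_le (by linarith : -1 < -α) (by linarith : -α ≤ α) m hθ0
    have herr := pade_error hα0 hα1 hm hθ0 (hθ n hn)
    set r := (padePoly (-α) m).eval (theta lhat t n l) / (padePoly α m).eval (theta lhat t n l)
      with hr
    have hr0 : 0 < r := div_pos hP hQ
    have hr1 : r ≤ 1 := (div_le_one hQ).2 hPQ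
    have hHs : H (n + 1) = (1 + theta lhat t n l) ^ (-α) * H n := by
      simp only [hH]
      rw [one_add_theta h0 ht hl0 hl hn,
        ← Real.mul_rpow (div_nonneg (hg _ (by omega)).le (hg _ (by omega)).le) (hg _ (by omega)).le,
        div_mul_cancel₀ _ (hg n (by omega)).ne']
    have hMs : M (n + 1) = r * M n := rfl
    have hsplit : H (n + 1) - M (n + 1) =
        ((1 + theta lhat t n l) ^ (-α) - r) * H n + r * (H n - M n) := by
      rw [hHs, hMs]; ring
    rw [hsplit]
    refine (abs_add_le _ _).trans (add_le_add ?_ ?_)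
    · rw [abs_mul, abs_of_pos hHpos, ← mul_assoc]
      exact mul_le_mul_of_nonneg_right herr hHpos.le
    · rw [abs_mul, abs_of_pos hr0]
      exact mul_le_of_le_one_left (abs_nonneg _) hr1
  change |H (n + 1) - M (n + 1)| ≤ C * (lhat ^ (-α) + ν / α * (lhat ^ (-α) - H n))
  induction n with
  | zero =>
    have h1 := hone 0 (Nat.zero_le _)
    rw [hM0, hH0, sub_self, abs_zero, add_zero] at h1
    rw [hH0, sub_self, mul_zero, add_zero]
    refine h1.trans (mul_le_mul_of_nonneg_left ?_ hC0)
    exact mul_le_of_le_one_left (Real.rpow_pos_of_pos hl0 _).le (hθ 0 (Nat.zero_le _))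
  | succ n ih =>
    have h1 := hone (n + 1) hn
    have hgn := hg (n + 1) (by omega)
    have hHpos : 0 < H (n + 1) := Real.rpow_pos_of_pos hgn _
    have hτ : step t (n + 1) ≤ ν * step t n :=
      (div_le_iff₀ (sub_pos.2 (ht n (by omega)))).1 (hstep n (by omega))
    have h2 : theta lhat t (n + 1) l * H (n + 1) ≤ ν / α * (H n - H (n + 1)) := by
      have h3 := sub_div_mul_rpow_le hα0 (hg n (by omega)) hgn
      have h4 : lhat + t (n + 1) * (l - lhat) - (lhat + t n * (l - lhat)) =
          step t n * (l - lhat) := by rw [step]; ring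
      rw [h4] at h3
      calc theta lhat t (n + 1) l * H (n + 1)
          ≤ ν * (step t n * (l - lhat) / (lhat + t (n + 1) * (l - lhat)) * H (n + 1)) := by
            rw [theta, ← mul_assoc, ← mul_div_assoc, ← mul_assoc]
            have := sub_nonneg.2 hl
            gcongr
        _ ≤ ν * ((H n - H (n + 1)) / α) := mul_le_mul_of_nonneg_left h3 hν
        _ = _ := by ring
    have h3 := ih (by omega)
    have h4 := mul_le_mul_of_nonneg_left h2 hC0
    linarith

/-- The scalar error estimate. -/
lemma abs_rpow_sub_mu_le_cTilde {α : ℝ} (hα0 : 0 < α) (hα1 : α < 1) {m : ℕ} (hm : 1 ≤ m)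
    (h0 : t 0 = 0) (h1 : t (L + 1) = 1) (ht : ∀ n ≤ L, t n < t (n + 1)) (hl0 : 0 < lhat)
    (hl : lhat ≤ l) (hθ : ∀ n ≤ L, theta lhat t n l ≤ 1) {ν : ℝ} (hν : 0 ≤ ν)
    (hstep : ∀ n < L, step t (n + 1) / step t n ≤ ν) :
    |l ^ (-α) - mu (padePoly (-α) m) (padePoly α m) α lhat t l (L + 1)| ≤
      cTilde α ν * lhat ^ (-α) * (2 : ℝ) ^ (-(5 * (m : ℝ))) := by
  have h := abs_rpow_sub_mu_le hα0 hα1 hm h0 ht hl0 hl hθ hν hstep le_rfl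
  rw [h1, one_mul, add_sub_cancel] at h
  refine h.trans ?_
  have hpow : (2 : ℝ) ^ (-(5 * (m : ℝ))) = (1 / 32) ^ m := by
    rw [← neg_mul, Real.rpow_mul (by norm_num), Real.rpow_natCast]
    congr 1
    rw [Real.rpow_neg (by norm_num), show (5 : ℝ) = ((5 : ℕ) : ℝ) by norm_num, Real.rpow_natCast]
    norm_num
  have hc : 0 ≤ 2 ^ α * cPrime α := (errorConst_pos hα0 hα1 m).le.trans (errorConst_le hα0 hα1 hm)
  have hH : 0 < (lhat + t L * (l - lhat)) ^ (-α) :=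
    Real.rpow_pos_of_pos (shift_pos h0 ht hl0 hl (by omega)) _
  rw [hpow]
  calc _ ≤ 2 ^ α * cPrime α * (1 / 32) ^ m * (lhat ^ (-α) + ν / α * (lhat ^ (-α))) := by
        gcongr
        linarith
    _ = _ := by
        rw [cTilde]
        field_simp

end Scalar

/-! ### Operators that are diagonal in an orthonormal basis -/

section Diagonal

variable {V ι : Type*} [NormedAddCommGroup V] [InnerProductSpace ℝ V] [Fintype ι]
  (b : OrthonormalBasis ι ℝ V)

lemma isUnit_of_diagonal {A : Module.End ℝ V} {a : ι → ℝ} (hA : ∀ j, A (b j) = a j • b j)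
    (ha : ∀ j, a j ≠ 0) : IsUnit A := by
  let B : Module.End ℝ V := b.toBasis.constr ℝ (fun j => (a j)⁻¹ • b j)
  have hB : ∀ j, B (b j) = (a j)⁻¹ • b j := fun j => by
    have := b.toBasis.constr_basis ℝ (fun j => (a j)⁻¹ • b j) j
    rwa [OrthonormalBasis.coe_toBasis] at this
  refine ⟨⟨A, B, ?_, ?_⟩, rfl⟩ <;> refine b.toBasis.ext fun j => ?_
  · simp [hB, hA, smul_smul, ha j]
  · simp [hB, hA, smul_smul, ha j]

lemma inverse_apply_of_diagonal {A : Module.End ℝ V} {v : V} {a : ℝ} (hu : IsUnit A)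
    (hA : A v = a • v) (ha : a ≠ 0) : Ring.inverse A v = a⁻¹ • v := by
  have h := congrArg (fun F : Module.End ℝ V => F v) (Ring.inverse_mul_cancel A hu)
  simp only [Module.End.mul_apply, Module.End.one_apply, hA, map_smul] at h
  rw [eq_inv_smul_iff₀ ha, h]

lemma aeval_apply_of_diagonal {A : Module.End ℝ V} {v : V} {a : ℝ} (hA : A v = a • v)
    (p : ℝ[X]) : aeval A p v = p.eval a • v := by
  rcases eq_or_ne v 0 with rfl | hv
  · simp
  · exact Module.End.aeval_apply_of_hasEigenvector ⟨Module.End.mem_eigenspace_iff.2 hA, hv⟩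

lemma norm_sum_smul_le {x y : ι → ℝ} {C : ℝ} (hC : 0 ≤ C) (h : ∀ j, |x j - y j| ≤ C) (f : V) :
    ‖∑ j, (x j * inner ℝ (b j) f) • b j - ∑ j, (y j * inner ℝ (b j) f) • b j‖ ≤ C * ‖f‖ := by
  rw [← Finset.sum_sub_distrib]
  refine le_of_sq_le_sq ?_ (mul_nonneg hC (norm_nonneg f))
  have h1 : ∀ j, (x j * inner ℝ (b j) f) • b j - (y j * inner ℝ (b j) f) • b j =
      ((x j - y j) * inner ℝ (b j) f) • b j := fun j => by rw [← sub_smul]; ring_nf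
  simp only [h1]
  rw [mul_pow, ← b.sum_sq_norm_inner_right f, ← b.sum_sq_norm_inner_right, Finset.mul_sum]
  refine Finset.sum_le_sum fun j _ => ?_
  rw [b.orthonormal.inner_right_fintype, norm_mul, mul_pow, Real.norm_eq_abs]
  gcongr
  exact h j

variable {lhat : ℝ} {t : ℕ → ℝ} {L : ℕ} {T : Module.End ℝ V} {e : ι → ℝ}

lemma shifted_apply_of_diagonal {v : V} {l : ℝ} (hT : T v = l • v) (n : ℕ) :
    shifted T lhat t n v = (lhat + t n * (l - lhat)) • v := by
  simp only [shifted, LinearMap.add_apply, LinearMap.smul_apply, LinearMap.sub_apply,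
    Module.End.one_apply, hT]
  module

lemma thetaOp_apply_of_diagonal {v : V} {l : ℝ} {n : ℕ} (hu : IsUnit (shifted T lhat t n))
    (hT : T v = l • v) (hne : lhat + t n * (l - lhat) ≠ 0) :
    thetaOp T lhat t n v = theta lhat t n l • v := by
  rw [thetaOp, Module.End.mul_apply,
    inverse_apply_of_diagonal hu (shifted_apply_of_diagonal hT n) hne, map_smul]
  simp only [LinearMap.smul_apply, LinearMap.sub_apply, Module.End.one_apply, hT, theta]
  rw [← sub_smul, smul_smul, smul_smul]
  congr 1
  ring

/-- In an orthonormal eigenbasis of `T`, the product scheme reduces to the scalar recurrence. -/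
lemma scheme_eq_sum {P Q : ℝ[X]} {α : ℝ} (hT : ∀ j, T (b j) = e j • b j)
    (hu : ∀ n ≤ L, IsUnit (shifted T lhat t n))
    (hne : ∀ n ≤ L, ∀ j, lhat + t n * (e j - lhat) ≠ 0)
    (huQ : ∀ n ≤ L, IsUnit (aeval (thetaOp T lhat t n) Q))
    (hQ : ∀ n ≤ L, ∀ j, Q.eval (theta lhat t n (e j)) ≠ 0) (f : V) {n : ℕ} (hn : n ≤ L + 1) :
    scheme P Q α T lhat t f n = ∑ j, (mu P Q α lhat t (e j) n * inner ℝ (b j) f) • b j := by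
  induction n with
  | zero =>
    conv_lhs => rw [scheme, ← b.sum_repr' f, Finset.smul_sum]
    simp only [smul_smul, mu]
  | succ n ih =>
    rw [scheme, ih (by omega), map_sum]
    refine Finset.sum_congr rfl fun j _ => ?_
    have h1 := thetaOp_apply_of_diagonal (hu n (by omega)) (hT j) (hne n (by omega) j)
    rw [map_smul, Module.End.mul_apply,
      inverse_apply_of_diagonal (huQ n (by omega)) (aeval_apply_of_diagonal h1 Q)
        (hQ n (by omega) j), map_smul, aeval_apply_of_diagonal h1 P, smul_smul, smul_smul, mu]
    congr 1
    ring

end Diagonal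

lemma hasEigenvalue_mem_Icc {S : TriangulatedSurface} {c : Coefficients S} {l : ℝ}
    (h : Module.End.HasEigenvalue (discreteOperator S c) l) :
    l ∈ Set.Icc (eigMin S c) (eigMax S c) := by
  have hfin : {l : ℝ | Module.End.HasEigenvalue (discreteOperator S c) l}.Finite :=
    Module.End.finite_hasEigenvalue _
  exact ⟨csInf_le hfin.bddBelow h, le_csSup hfin.bddAbove h⟩

end PadeFEM

theorem mainTheorem2
    (S : TriangulatedSurface) (c : Coefficients S)
    (α : ℝ) (hα0 : 0 < α) (hα1 : α < 1) (m : ℕ) (hm : 1 ≤ m) :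
    (∃! PQ : ℝ[X] × ℝ[X], IsPade α m PQ.1 PQ.2) ∧
    ∀ P Q : ℝ[X], IsPade α m P Q →
    ∀ lhat : ℝ, 0 < lhat → lhat ≤ eigMin S c →
    ∀ (L : ℕ) (t : ℕ → ℝ), t 0 = 0 → t (L + 1) = 1 → (∀ n ≤ L, t n < t (n + 1)) →
      (∀ n ≤ L, theta lhat t n (eigMax S c) ≤ 1) →
    ∀ ν : ℝ, 0 ≤ ν → (∀ n < L, step t (n + 1) / step t n ≤ ν) →
      (∀ l ∈ Set.Icc (eigMin S c) (eigMax S c),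
        (∀ n ≤ L, Q.eval (theta lhat t n l) ≠ 0) ∧
        |l ^ (-α) - mu P Q α lhat t l (L + 1)| ≤
          cTilde α ν * lhat ^ (-α) * (2 : ℝ) ^ (-(5 * (m : ℝ)))) ∧
      (∀ n ≤ L, IsUnit (shifted (discreteOperator S c) lhat t n) ∧
        IsUnit (aeval (thetaOp (discreteOperator S c) lhat t n) Q)) ∧
      ∀ f : FESpace S c,
        ‖spectralPower (discreteOperator_symmetric S c) (-α) f -
            scheme P Q α (discreteOperator S c) lhat t f (L + 1)‖ ≤
          cTilde α ν * lhat ^ (-α) * (2 : ℝ) ^ (-(5 * (m : ℝ))) * ‖f‖ := by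
  refine ⟨⟨(padePoly (-α) m, padePoly α m), isPade_padePoly α hm, fun PQ h =>
    Prod.ext (h.eq_padePoly hα0 hα1 hm).1 (h.eq_padePoly hα0 hα1 hm).2⟩, ?_⟩
  intro P Q hPQ lhat hl0 hlmin L t h0 h1 ht hθ ν hν hstep
  obtain ⟨rfl, rfl⟩ := hPQ.eq_padePoly hα0 hα1 hm
  have hQ : ∀ l ∈ Set.Icc (eigMin S c) (eigMax S c), ∀ n ≤ L,
      (padePoly α m).eval (theta lhat t n l) ≠ 0 := fun l hl n hn =>
    (eval_padePoly_pos (by linarith) m (theta_nonneg h0 ht hl0 (hlmin.trans hl.1) hn)).ne'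
  have hscalar : ∀ l ∈ Set.Icc (eigMin S c) (eigMax S c),
      |l ^ (-α) - mu (padePoly (-α) m) (padePoly α m) α lhat t l (L + 1)| ≤
        cTilde α ν * lhat ^ (-α) * (2 : ℝ) ^ (-(5 * (m : ℝ))) := fun l hl =>
    abs_rpow_sub_mu_le_cTilde hα0 hα1 hm h0 h1 ht hl0 (hlmin.trans hl.1)
      (fun n hn => (theta_mono h0 ht hl0 (hlmin.trans hl.1) hl.2 hn).trans (hθ n hn)) hν hstep
  set hsym := discreteOperator_symmetric S c
  set b := hsym.eigenvectorBasis rfl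
  set e := hsym.eigenvalues rfl
  have hT : ∀ j, discreteOperator S c (b j) = e j • b j := fun j =>
    hsym.apply_eigenvectorBasis rfl j
  have he : ∀ j, e j ∈ Set.Icc (eigMin S c) (eigMax S c) := fun j =>
    hasEigenvalue_mem_Icc (hsym.hasEigenvalue_eigenvalues rfl j)
  have hne : ∀ n ≤ L, ∀ j, lhat + t n * (e j - lhat) ≠ 0 := fun n hn j =>
    (shift_pos h0 ht hl0 (hlmin.trans (he j).1) (by omega)).ne'
  have hu : ∀ n ≤ L, IsUnit (shifted (discreteOperator S c) lhat t n) := fun n hn =>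
    isUnit_of_diagonal b (fun j => shifted_apply_of_diagonal (hT j) n) (hne n hn)
  have huQ : ∀ n ≤ L, IsUnit (aeval (thetaOp (discreteOperator S c) lhat t n) (padePoly α m)) :=
    fun n hn => isUnit_of_diagonal b (fun j => aeval_apply_of_diagonal
      (thetaOp_apply_of_diagonal (hu n hn) (hT j) (hne n hn j)) _) fun j => hQ _ (he j) n hn
  refine ⟨fun l hl => ⟨hQ l hl, hscalar l hl⟩, fun n hn => ⟨hu n hn, huQ n hn⟩, fun f => ?_⟩
  rw [scheme_eq_sum b hT hu hne huQ (fun n hn j => hQ _ (he j) n hn) f le_rfl]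
  refine norm_sum_smul_le b ?_ (fun j => hscalar _ (he j)) f
  have hc : 0 ≤ 2 ^ α * cPrime α := (errorConst_pos hα0 hα1 m).le.trans (errorConst_le hα0 hα1 hm)
  have hcT : cTilde α ν = (α + ν) * (2 ^ α * cPrime α) / α := by rw [cTilde]; ring
  rw [hcT]
  positivity
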